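/- Let $R$ be an integral domain of characteristic zero and let $G=(G^{(1)},\dots,G^{(m)})$ be an $m$-dimensional formal group law over $R$, that is, $G^{(j)}(X,Y)\in R[[X,Y]]$ with $G^{(j)}(X,Y)=X_j+Y_j+\sum_{l,k}\gamma_{lk}^jX_lY_k+O(d\ge 3)$ and $G(G(X,Y),Z)=G(X,G(Y,Z))$. Let $\mathcal O(G)=R[[t^{(1)},\dots,t^{(m)}]]$, with comultiplication $f\mapsto f(G(t_1,t_2))$, and let $\mathfrak g$ be the Lie algebra of $G$: the free $R$-module on $e_1,\dots,e_m$ with $[e_l,e_k]=\sum_j(\gamma_{lk}^j-\gamma_{kl}^j)e_j$. For $f\in\mathcal O(G)$ let $df\in\operatorname{Hom}_R(\mathfrak g,R)$ be $df(\sum_j r_je_j)=\sum_j r_j\frac{\partial f}{\partial t^{(j)}}(0)$. Let $\mathcal D$ be the continuous $R$-linear dual of $\mathcal O(G)$, with the algebra structure dual to the comultiplication, and let $\alpha:\mathcal U(\mathfrak g)\to\mathcal D$ be the algebra homomorphism with $\alpha(L)(f)=df(L)$ for $L\in\mathfrak g$. Let $K^n(G,R)=\mathcal O(G)^{\hat\otimes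 n}=R[[t_1^{(1)},\dots,t_n^{(m)}]]$, with differential $$\partial f(t_1,\dots,t_{n+1})=f(t_2,\dots,t_{n+1})+\sum_{i=1}^n(-1)^if(t_1,\dots,G(t_i,t_{i+1}),\dots,t_{n+1})+(-1)^{n+1}f(t_1,\dots,t_n),$$ and let $C^n(\mathfrak g,R)=\operatorname{Hom}_R(\bigwedge^n\mathfrak g,R)$, with differential $$\partial'\omega(x_1\wedge\dots\wedge x_{n+1})=\sum_{r<s}(-1)^{r+s}\omega([x_r,x_s]\wedge x_1\wedge\dots\widehat{x_r}\dots\widehat{x_s}\dots\wedge x_{n+1}).$$ Let $\phi^n:K^n(G,R)\to C^n(\mathfrak g,R)$ be the composition $$K^n(G,R)\to\operatorname{Hom}_R(\mathcal U(\mathfrak g)^{\otimes n},R)\xrightarrow{\ \iota\ }\operatorname{Hom}_{\mathcal U(\mathfrak g)}(\mathcal U(\mathfrak g)^{\otimes n+1},R)\xrightarrow{\ \nu\ }\operatorname{Hom}_{\mathcal U(\mathfrak g)}(\mathcal U(\mathfrak g)\otimes\textstyle\bigwedge^n\mathfrak g,R)\xrightarrow{\ \kappa\ }C^n(\mathfrak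 g,R),$$ where $R$ is the trivial $\mathcal U(\mathfrak g)$-module, the first map sends $f$ to $u_1\otimes\dots\otimes u_n\mapsto(\alpha(u_1)\hat\otimes\cdots\hat\otimes\alpha(u_n))(f)$, $\iota$ is the isomorphism from inhomogeneous to homogeneous cochains, $\nu$ is induced by the anti-symmetrisation $x_1\wedge\dots\wedge x_n\mapsto\sum_{\sigma\in S_n}\operatorname{sgn}(\sigma)\,x_{\sigma(1)}\otimes\dots\otimes x_{\sigma(n)}$, and $\kappa(\varphi)(w)=\varphi(1\otimes w)$. Then: 1. $\phi$ is a morphism of complexes: $\phi^{n+1}(\partial f)=\partial'\phi^n(f)$ for all $n\ge 0$ and $f\in K^n(G,R)$. 2. For $n\ge1$, $\phi^n$ is the continuous extension of $f_1\otimes\cdots\otimes f_n\mapsto df_1\wedge\cdots\wedge df_n$, where $(df_1\wedge\cdots\wedge df_n)(x_1\wedge\dots\wedge x_n)=\det(df_i(x_j))$. That is, $\phi^n$ is continuous for the topology of the total degree filtration on $K^n(G,R)$ and the discrete topology on $C^n(\mathfrak g,R)$, it takes these values, and it is the only continuous $R$-linear map that does. 3. $\phi^0$ is the identity of $K^0(G,R)=R=C^0(\mathfrak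 g,R)$. 4. Consequently $\phi$ agrees with the Huber–Kings differentiation of locally analytic cochains: let $K$ be a finite extension of $\mathbb Q_p$ for a prime $p$, let $R\to K$ be a ring homomorphism and $G_K$ the base change of $G$. If a $K$-valued function $f(z_1,\dots,z_n)$ of $z_i\in K^m$ is given near the origin by a convergent power series $F\in K^n(G_K,K)$, then for all $x_1,\dots,x_n\in\mathfrak g_K=K^m$ $$\phi^n(F)(x_1\wedge\dots\wedge x_n)=\sum_{\sigma\in S_n}\operatorname{sgn}(\sigma)\,\partial^{(1)}_{x_{\sigma(1)}}\cdots\partial^{(n)}_{x_{\sigma(n)}}f(0),$$ where $\partial^{(i)}_x$ is the derivative in the direction $x$ in the variable $z_i$. -/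

import Mathlib

open scoped TensorProduct

/-- The descending filtration of a power series ring by total degree. -/
def degFiltration (σ R : Type*) [CommRing R] (N : ℕ) : Submodule R (MvPowerSeries σ R) where
  carrier := {f | ∀ d : σ →₀ ℕ, d.degree < N → MvPowerSeries.coeff d f = 0}
  add_mem' hf hg d hd := by rw [map_add, hf d hd, hg d hd, add_zero]
  zero_mem' _ _ := map_zero _
  smul_mem' r f hf d hd := by
    have h := hf d hd
    rw [MvPowerSeries.coeff_smul, h, mul_zero]

/-- Continuity of a linear map from a power series ring, with the topology of the filtration by
total degree, to a discrete module. -/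
def IsDegContinuous {σ R M : Type*} [CommRing R] [AddCommGroup M] [Module R M]
    (φ : MvPowerSeries σ R →ₗ[R] M) : Prop :=
  ∃ N : ℕ, ∀ f ∈ degFiltration σ R N, φ f = 0

/-- The continuous `R`-linear dual of a power series ring. -/
def contDual (σ R : Type*) [CommRing R] : Submodule R (MvPowerSeries σ R →ₗ[R] R) where
  carrier := {φ | IsDegContinuous φ}
  add_mem' := by
    rintro φ ψ ⟨N, hN⟩ ⟨M, hM⟩
    refine ⟨max N M, fun f hf => ?_⟩
    rw [LinearMap.add_apply, hN f fun d hd => hf d (lt_max_of_lt_left hd),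
      hM f fun d hd => hf d (lt_max_of_lt_right hd), add_zero]
  zero_mem' := ⟨0, fun _ _ => rfl⟩
  smul_mem' := by
    rintro r φ ⟨N, hN⟩
    exact ⟨N, fun f hf => by rw [LinearMap.smul_apply, hN f hf, smul_zero]⟩

lemma mem_degFiltration {σ R : Type*} [CommRing R] {N : ℕ} {f : MvPowerSeries σ R} :
    f ∈ degFiltration σ R N ↔ (N : ℕ∞) ≤ f.order :=
  ⟨fun h => MvPowerSeries.nat_le_order h, fun h d hd =>
    MvPowerSeries.coeff_of_lt_order (lt_of_lt_of_le (by exact_mod_cast hd) h)⟩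

lemma finite_degree_lt {σ : Type*} [Finite σ] (N : ℕ) : {d : σ →₀ ℕ | d.degree < N}.Finite := by
  classical
  refine Set.Finite.subset (Set.finite_Icc 0 (Finsupp.equivFunOnFinite.symm fun _ => N)) ?_
  refine fun d hd => ⟨zero_le, fun i => ?_⟩
  have : d i ≤ d.degree := Finsupp.le_degree i d
  simp at hd ⊢
  omega

lemma IsDegContinuous.exists_sum {σ R M : Type*} [Finite σ] [CommRing R] [AddCommGroup M]
    [Module R M] {φ : MvPowerSeries σ R →ₗ[R] M} (hφ : IsDegContinuous φ) :
    ∃ N : ℕ, ∀ K, N ≤ K → ∀ f, φ f = ∑ d ∈ (finite_degree_lt (σ := σ) K).toFinset,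
      MvPowerSeries.coeff d f • φ (MvPowerSeries.monomial d 1) := by
  classical
  obtain ⟨N, hN⟩ := hφ
  refine ⟨N, fun K hK f => ?_⟩
  have h1 := hN (f - ∑ d ∈ (finite_degree_lt (σ := σ) K).toFinset,
      MvPowerSeries.coeff d f • MvPowerSeries.monomial d 1) fun d hd => ?_
  · rw [map_sub, sub_eq_zero] at h1
    simp only [h1, map_sum, map_smul]
  · rw [map_sub, map_sum, Finset.sum_eq_single d]
    · simp
    · intro b _ hb
      simp [MvPowerSeries.coeff_monomial, hb.symm]
    · intro h
      simp at h
      omega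

/-- Two continuous linear maps that agree on monomials are equal. -/
lemma IsDegContinuous.ext_monomial {σ R M : Type*} [Finite σ] [CommRing R] [AddCommGroup M]
    [Module R M] {φ ψ : MvPowerSeries σ R →ₗ[R] M} (hφ : IsDegContinuous φ)
    (hψ : IsDegContinuous ψ)
    (h : ∀ d, φ (MvPowerSeries.monomial d 1) = ψ (MvPowerSeries.monomial d 1)) : φ = ψ := by
  obtain ⟨N, hN⟩ := hφ.exists_sum
  obtain ⟨M, hM⟩ := hψ.exists_sum
  ext f
  rw [hN _ (le_max_left N M), hM _ (le_max_right N M)]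
  simp only [h]

/-- Substitution of power series without constant term, as a linear map. -/
noncomputable def substLin {σ τ R : Type*} [Finite σ] [CommRing R] (a : σ → MvPowerSeries τ R)
    (ha : ∀ i, MvPowerSeries.constantCoeff (a i) = 0) :
    MvPowerSeries σ R →ₗ[R] MvPowerSeries τ R :=
  (MvPowerSeries.substAlgHom (R := R)
    (MvPowerSeries.hasSubst_of_constantCoeff_zero ha)).toLinearMap

lemma substLin_apply {σ τ R : Type*} [Finite σ] [CommRing R] (a : σ → MvPowerSeries τ R)
    (ha : ∀ i, MvPowerSeries.constantCoeff (a i) = 0) (f : MvPowerSeries σ R) :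
    substLin a ha f = MvPowerSeries.subst a f := by
  simp [substLin]

lemma one_le_order_of_const {σ R : Type*} [CommRing R] {f : MvPowerSeries σ R}
    (hf : MvPowerSeries.constantCoeff f = 0) : 1 ≤ f.order := by
  refine MvPowerSeries.le_order fun d hd => ?_
  have h : d.degree = 0 := by
    rw [← Nat.lt_one_iff]
    exact_mod_cast hd
  rw [(Finsupp.degree_eq_zero_iff d).1 h, MvPowerSeries.coeff_zero_eq_constantCoeff_apply, hf]

lemma substLin_mem {σ τ R : Type*} [Finite σ] [CommRing R] {a : σ → MvPowerSeries τ R}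
    (ha : ∀ i, MvPowerSeries.constantCoeff (a i) = 0) {N : ℕ} {f : MvPowerSeries σ R}
    (hf : f ∈ degFiltration σ R N) : substLin a ha f ∈ degFiltration τ R N := by
  rw [mem_degFiltration] at hf ⊢
  rw [substLin_apply]
  refine le_trans ?_
    (MvPowerSeries.le_order_subst (MvPowerSeries.hasSubst_of_constantCoeff_zero ha) f)
  calc (N : ℕ∞) = 1 * N := (one_mul _).symm
    _ ≤ _ := mul_le_mul' (le_iInf fun i => one_le_order_of_const (ha i)) hf

lemma IsDegContinuous.comp_subst {σ τ R M : Type*} [Finite σ] [CommRing R] [AddCommGroup M]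
    [Module R M] {a : σ → MvPowerSeries τ R}
    (ha : ∀ i, MvPowerSeries.constantCoeff (a i) = 0)
    {φ : MvPowerSeries τ R →ₗ[R] M} (hφ : IsDegContinuous φ) :
    IsDegContinuous (φ ∘ₗ substLin a ha) := by
  obtain ⟨N, hN⟩ := hφ
  exact ⟨N, fun f hf => hN _ (substLin_mem ha hf)⟩

lemma IsDegContinuous.comp_mulRight {σ R M : Type*} [CommRing R] [AddCommGroup M]
    [Module R M] (g : MvPowerSeries σ R)
    {φ : MvPowerSeries σ R →ₗ[R] M} (hφ : IsDegContinuous φ) :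
    IsDegContinuous (φ ∘ₗ LinearMap.mulRight R g) := by
  obtain ⟨N, hN⟩ := hφ
  refine ⟨N, fun f hf => hN _ ?_⟩
  rw [mem_degFiltration] at hf ⊢
  refine le_trans ?_ MvPowerSeries.le_order_mul
  exact le_add_right hf

/-- The exponent of the `i`-th group of variables in an exponent of `n` groups of `m` variables. -/
noncomputable def expRow {n m : ℕ} (d : Fin n × Fin m →₀ ℕ) (i : Fin n) : Fin m →₀ ℕ :=
  Finsupp.equivFunOnFinite.symm fun j => d (i, j)

lemma finite_contDual_support {n m : ℕ} {R : Type*} [CommRing R]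
    (φ : Fin n → contDual (Fin m) R) :
    {d : Fin n × Fin m →₀ ℕ |
      ∏ i, (φ i).1 (MvPowerSeries.monomial (expRow d i) 1) ≠ 0}.Finite := by
  classical
  choose N hN using fun i => (φ i).2
  refine Set.Finite.subset
    (Set.finite_Icc 0 (Finsupp.equivFunOnFinite.symm fun p => N p.1)) ?_
  refine fun d hd => ⟨zero_le, fun p => ?_⟩
  by_contra hp
  apply hd
  refine Finset.prod_eq_zero (Finset.mem_univ p.1) (hN _ _ fun e he => ?_)
  rw [MvPowerSeries.coeff_monomial, if_neg]
  rintro rfl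
  have := Finsupp.le_degree p.2 (expRow d p.1)
  simp [expRow] at this hp he
  omega

/-- The completed tensor product of continuous functionals: the continuous extension to power series
in `n` groups of `m` variables of `f₁ ⊗ ⋯ ⊗ fₙ ↦ φ₁ f₁ ⋯ φₙ fₙ`. -/
noncomputable def tensorDual {n m : ℕ} {R : Type*} [CommRing R] :
    MultilinearMap R (fun _ : Fin n => contDual (Fin m) R)
      (MvPowerSeries (Fin n × Fin m) R →ₗ[R] R) where
  toFun φ :=
    { toFun := fun F => ∑ᶠ d : Fin n × Fin m →₀ ℕ,
        MvPowerSeries.coeff d F * ∏ i, (φ i).1 (MvPowerSeries.monomial (expRow d i) 1)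
      map_add' := fun F F' => by
        rw [← finsum_add_distrib]
        · simp only [map_add, add_mul]
        · exact (finite_contDual_support φ).subset fun d => right_ne_zero_of_mul
        · exact (finite_contDual_support φ).subset fun d => right_ne_zero_of_mul
      map_smul' := fun r F => by
        simp only [MvPowerSeries.coeff_smul, mul_assoc, RingHom.id_apply, smul_eq_mul]
        rw [mul_finsum']
        exact (finite_contDual_support φ).subset fun d => right_ne_zero_of_mul }
  map_update_add' {inst} φ i x y := by
    have : inst = instDecidableEqFin n := Subsingleton.elim _ _
    subst this
    ext F
    simp only [LinearMap.coe_mk, AddHom.coe_mk, LinearMap.add_apply]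
    rw [← finsum_add_distrib]
    · refine finsum_congr fun d => ?_
      rw [← mul_add]
      congr 1
      simp only [← Finset.mul_prod_erase Finset.univ _ (Finset.mem_univ i),
        Function.update_self, Submodule.coe_add, LinearMap.add_apply, add_mul]
      congr 2 <;>
      · refine Finset.prod_congr rfl fun k hk => ?_
        simp [Function.update_of_ne (Finset.ne_of_mem_erase hk)]
    · exact (finite_contDual_support (Function.update φ i x)).subset
        fun d => right_ne_zero_of_mul
    · exact (finite_contDual_support (Function.update φ i y)).subset
        fun d => right_ne_zero_of_mul
  map_update_smul' {inst} φ i r x := by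
    have : inst = instDecidableEqFin n := Subsingleton.elim _ _
    subst this
    ext F
    simp only [LinearMap.coe_mk, AddHom.coe_mk, LinearMap.smul_apply, smul_eq_mul]
    rw [mul_finsum']
    · refine finsum_congr fun d => ?_
      rw [mul_left_comm]
      congr 1
      simp only [← Finset.mul_prod_erase Finset.univ _ (Finset.mem_univ i),
        Function.update_self, Submodule.coe_smul, LinearMap.smul_apply, smul_eq_mul, mul_assoc]
      congr 2
      refine Finset.prod_congr rfl fun k hk => ?_
      simp [Function.update_of_ne (Finset.ne_of_mem_erase hk)]
    · exact (finite_contDual_support (Function.update φ i x)).subset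
        fun d => right_ne_zero_of_mul

lemma tensorDual_apply {n m : ℕ} {R : Type*} [CommRing R] (φ : Fin n → contDual (Fin m) R)
    (F : MvPowerSeries (Fin n × Fin m) R) :
    tensorDual φ F = ∑ᶠ d : Fin n × Fin m →₀ ℕ,
        MvPowerSeries.coeff d F * ∏ i, (φ i).1 (MvPowerSeries.monomial (expRow d i) 1) := rfl

lemma tensorDual_monomial {n m : ℕ} {R : Type*} [CommRing R] (φ : Fin n → contDual (Fin m) R)
    (d : Fin n × Fin m →₀ ℕ) :
    tensorDual φ (MvPowerSeries.monomial d 1) =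
      ∏ i, (φ i).1 (MvPowerSeries.monomial (expRow d i) 1) := by
  classical
  rw [tensorDual_apply, finsum_eq_single _ d]
  · simp
  · intro e he
    simp [MvPowerSeries.coeff_monomial, he]

lemma tensorDual_continuous {n m : ℕ} {R : Type*} [CommRing R]
    (φ : Fin n → contDual (Fin m) R) : IsDegContinuous (tensorDual φ) := by
  refine ⟨(finite_contDual_support φ).toFinset.sup Finsupp.degree + 1, fun F hF => ?_⟩
  rw [tensorDual_apply]
  refine finsum_eq_zero_of_forall_eq_zero fun d => ?_
  by_cases hd : ∏ i, (φ i).1 (MvPowerSeries.monomial (expRow d i) 1) = 0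
  · rw [hd, mul_zero]
  · rw [hF d, zero_mul]
    exact Nat.lt_succ_of_le (Finset.le_sup (f := Finsupp.degree)
      ((finite_contDual_support φ).mem_toFinset.2 hd))

/-- The `i`-th group of variables among `n` groups of `m` variables. -/
noncomputable def slotVars (R : Type*) [CommRing R] (m : ℕ) {n : ℕ} (i : Fin n) :
    Fin m → MvPowerSeries (Fin n × Fin m) R :=
  fun j => MvPowerSeries.X (i, j)

/-- Substitution of two tuples of power series into a tuple of power series in two groups of
variables: `g(a, b)`. -/
noncomputable def substPair {R τ : Type*} [CommRing R] {m : ℕ}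
    (g : Fin m → MvPowerSeries (Fin 2 × Fin m) R) (a b : Fin m → MvPowerSeries τ R) :
    Fin m → MvPowerSeries τ R :=
  fun j => MvPowerSeries.subst (fun p => ![a, b] p.1 p.2) (g j)

/-- An `m`-dimensional formal group law over `R`. The variables `(0, j)` are the `X_j`, the
variables `(1, j)` are the `Y_j`. -/
structure FormalGroupLaw (R : Type*) [CommRing R] (m : ℕ) where
  /-- The tuple of power series `G⁽ʲ⁾(X, Y)`. -/
  series : Fin m → MvPowerSeries (Fin 2 × Fin m) R
  /-- `G⁽ʲ⁾(X, Y) = X_j + Y_j + ∑ γ_{lk}^j X_l Y_k + O(d ≥ 3)`. -/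
  low_degree : ∃ γ : Fin m → Fin m → Fin m → R, ∀ (j : Fin m) (d : Fin 2 × Fin m →₀ ℕ),
    d.degree < 3 → MvPowerSeries.coeff d (series j) =
      MvPowerSeries.coeff d (MvPowerSeries.X (0, j) + MvPowerSeries.X (1, j) +
        ∑ l, ∑ k, MvPowerSeries.C (γ j l k) * MvPowerSeries.X (0, l) * MvPowerSeries.X (1, k))
  /-- `G(G(X, Y), Z) = G(X, G(Y, Z))`. -/
  assoc : substPair series (substPair series (slotVars R m (0 : Fin 3)) (slotVars R m 1))
      (slotVars R m 2) =
    substPair series (slotVars R m (0 : Fin 3))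
      (substPair series (slotVars R m 1) (slotVars R m 2))

namespace FormalGroupLaw

variable {R : Type*} [CommRing R] {m : ℕ} (G : FormalGroupLaw R m)

lemma constantCoeff_series (j : Fin m) : MvPowerSeries.constantCoeff (G.series j) = 0 := by
  obtain ⟨γ, hγ⟩ := G.low_degree
  have := hγ j 0 (by simp)
  simpa using this

/-- The comultiplication `f ↦ f(G(t₁, t₂))` of the ring of functions. -/
noncomputable def comul : MvPowerSeries (Fin m) R →ₗ[R] MvPowerSeries (Fin 2 × Fin m) R :=
  substLin G.series G.constantCoeff_series

end FormalGroupLaw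

lemma tensorDual_mul_slot {R : Type*} [CommRing R] {m n n' : ℕ} (Φ : Fin n → contDual (Fin m) R)
    (e : Fin n' → Fin n) (he : Function.Injective e) (k : Fin n) (hk : ∀ i, e i ≠ k)
    (hek : ∀ i, i = k ∨ ∃ i', e i' = i)
    (A : MvPowerSeries (Fin n' × Fin m) R) (b : Fin m →₀ ℕ) :
    tensorDual Φ (MvPowerSeries.subst (fun p => MvPowerSeries.X (R := R) (e p.1, p.2)) A *
      MvPowerSeries.monomial (b.mapDomain fun j => (k, j)) 1) =
    tensorDual (fun i => Φ (e i)) A * (Φ k).1 (MvPowerSeries.monomial b 1) := by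
  classical
  have hc : ∀ p : Fin n' × Fin m, MvPowerSeries.constantCoeff
      (MvPowerSeries.X (R := R) (e p.1, p.2)) = 0 := by simp
  have key := IsDegContinuous.ext_monomial (R := R)
    (((tensorDual_continuous Φ).comp_mulRight
      (MvPowerSeries.monomial (b.mapDomain fun j => (k, j)) 1)).comp_subst hc)
    ((contDual (Fin n' × Fin m) R).smul_mem ((Φ k).1 (MvPowerSeries.monomial b 1))
      (tensorDual_continuous fun i => Φ (e i))) ?_
  · have := DFunLike.congr_fun key A
    simp only [LinearMap.comp_apply, substLin_apply, LinearMap.mulRight_apply,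
      LinearMap.smul_apply, smul_eq_mul] at this
    rw [this, mul_comm]
  · intro d
    have hX : MvPowerSeries.subst
        (fun p : Fin n' × Fin m => MvPowerSeries.X (R := R) (e p.1, p.2))
        (MvPowerSeries.monomial d (1 : R)) =
        MvPowerSeries.monomial (d.mapDomain fun p => (e p.1, p.2)) 1 := by
      rw [MvPowerSeries.subst_monomial (MvPowerSeries.hasSubst_of_constantCoeff_zero hc)]
      simp [MvPowerSeries.monomial_mapDomain_apply_one]
    simp only [LinearMap.comp_apply, substLin_apply, LinearMap.mulRight_apply,
      LinearMap.smul_apply, smul_eq_mul, hX, MvPowerSeries.monomial_mul_monomial, one_mul,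
      tensorDual_monomial]
    have hinj : Function.Injective (fun p : Fin n' × Fin m => (e p.1, p.2)) := by
      rintro ⟨i, j⟩ ⟨i', j'⟩ h
      simp only [Prod.mk.injEq] at h ⊢
      exact ⟨he h.1, h.2⟩
    have e0 : ∀ i, expRow (d.mapDomain (fun p => (e p.1, p.2)) +
        b.mapDomain fun j => (k, j)) (e i) = expRow d i := by
      intro i
      ext j
      simp only [expRow, Finsupp.equivFunOnFinite_symm_apply_apply, Finsupp.add_apply]
      rw [Finsupp.mapDomain_of_notMem_range (b : Fin m →₀ ℕ) _ (by simp [(hk i).symm]),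
        show (e i, j) = (fun p : Fin n' × Fin m => (e p.1, p.2)) (i, j)
          from rfl, Finsupp.mapDomain_apply hinj, add_zero]
    have e2 : expRow (d.mapDomain (fun p => (e p.1, p.2)) +
        b.mapDomain fun j => (k, j)) k = b := by
      ext j
      simp only [expRow, Finsupp.equivFunOnFinite_symm_apply_apply, Finsupp.add_apply]
      rw [Finsupp.mapDomain_of_notMem_range, zero_add, Finsupp.mapDomain_apply]
      · intro a b h
        simpa using h
      · rintro ⟨⟨i, j⟩, h⟩
        simp [hk] at h
    have hu : (Finset.univ : Finset (Fin n)) = insert k (Finset.univ.image e) := by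
      ext i
      simpa using hek i
    rw [hu, Finset.prod_insert (by simp [hk]), Finset.prod_image (fun a _ b _ h => he h), e2]
    simp only [e0]

lemma subst_monomial_one {σ τ R : Type*} [Finite σ] [CommRing R] {a : σ → MvPowerSeries τ R}
    (ha : ∀ i, MvPowerSeries.constantCoeff (a i) = 0) (d : σ →₀ ℕ) :
    MvPowerSeries.subst a (MvPowerSeries.monomial d (1 : R)) = d.prod fun i k => a i ^ k := by
  rw [MvPowerSeries.subst_monomial (MvPowerSeries.hasSubst_of_constantCoeff_zero ha)]
  simp

lemma exp_eq_add {m : ℕ} (d : Fin 2 × Fin m →₀ ℕ) :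
    d = (expRow d 0).mapDomain (fun j => (0, j)) + (expRow d 1).mapDomain (fun j => (1, j)) := by
  ext ⟨i, j⟩
  have h0 : Function.Injective fun j : Fin m => ((0 : Fin 2), j) := fun a b h => by simpa using h
  have h1 : Function.Injective fun j : Fin m => ((1 : Fin 2), j) := fun a b h => by simpa using h
  fin_cases i
  · have := Finsupp.mapDomain_apply h0 (expRow d 0) j
    simp only [Fin.zero_eta, Finsupp.add_apply] at this ⊢
    rw [this, Finsupp.mapDomain_of_notMem_range _ _ (by simp)]
    simp [expRow]
  · have := Finsupp.mapDomain_apply h1 (expRow d 1) j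
    simp only [Fin.mk_one, Finsupp.add_apply] at this ⊢
    rw [this, Finsupp.mapDomain_of_notMem_range _ _ (by simp)]
    simp [expRow]

lemma prod_pair_exp {S : Type*} [CommMonoid S] {m : ℕ} (d : Fin 2 × Fin m →₀ ℕ)
    (a b : Fin m → S) :
    (d.prod fun p k => ![a, b] p.1 p.2 ^ k) =
      ((expRow d 0).prod fun j k => a j ^ k) * ((expRow d 1).prod fun j k => b j ^ k) := by
  classical
  conv_lhs => rw [exp_eq_add d]
  rw [Finsupp.prod_add_index' (by simp) (by simp [pow_add]),
    Finsupp.prod_mapDomain_index (by simp) (by simp [pow_add]),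
    Finsupp.prod_mapDomain_index (by simp) (by simp [pow_add])]
  simp

namespace FormalGroupLaw

variable {R : Type*} [CommRing R] {m : ℕ} (G : FormalGroupLaw R m)

lemma comul_apply (f : MvPowerSeries (Fin m) R) :
    G.comul f = MvPowerSeries.subst G.series f := substLin_apply _ _ _

lemma constantCoeff_substPair {τ : Type*} {a b : Fin m → MvPowerSeries τ R}
    (ha : ∀ j, MvPowerSeries.constantCoeff (a j) = 0)
    (hb : ∀ j, MvPowerSeries.constantCoeff (b j) = 0) (j : Fin m) :
    MvPowerSeries.constantCoeff (substPair G.series a b j) = 0 := by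
  have h : ∀ p : Fin 2 × Fin m, MvPowerSeries.constantCoeff (![a, b] p.1 p.2) = 0 := by
    rintro ⟨i, j⟩
    fin_cases i <;> simp [ha, hb]
  exact MvPowerSeries.constantCoeff_subst_eq_zero
    (MvPowerSeries.hasSubst_of_constantCoeff_zero h) h (G.constantCoeff_series j)

lemma subst_comul {τ : Type*} {a b : Fin m → MvPowerSeries τ R}
    (ha : ∀ j, MvPowerSeries.constantCoeff (a j) = 0)
    (hb : ∀ j, MvPowerSeries.constantCoeff (b j) = 0) (f : MvPowerSeries (Fin m) R) :
    MvPowerSeries.subst (fun p : Fin 2 × Fin m => ![a, b] p.1 p.2) (G.comul f) =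
      MvPowerSeries.subst (substPair G.series a b) f := by
  have h : ∀ p : Fin 2 × Fin m, MvPowerSeries.constantCoeff (![a, b] p.1 p.2) = 0 := by
    rintro ⟨i, j⟩
    fin_cases i <;> simp [ha, hb]
  rw [comul_apply, MvPowerSeries.subst_comp_subst_apply
    (MvPowerSeries.hasSubst_of_constantCoeff_zero G.constantCoeff_series)
    (MvPowerSeries.hasSubst_of_constantCoeff_zero h)]
  rfl

/-- The convolution product on the continuous dual, dual to the comultiplication. -/
noncomputable def convMul (φ ψ : contDual (Fin m) R) : contDual (Fin m) R :=
  ⟨tensorDual ![φ, ψ] ∘ₗ G.comul,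
    (tensorDual_continuous ![φ, ψ]).comp_subst G.constantCoeff_series⟩

lemma convMul_apply (φ ψ : contDual (Fin m) R) (f : MvPowerSeries (Fin m) R) :
    (G.convMul φ ψ).1 f = tensorDual ![φ, ψ] (G.comul f) := rfl

lemma tensorDual_convMul_left (φ ψ χ : contDual (Fin m) R)
    (F : MvPowerSeries (Fin 2 × Fin m) R) :
    tensorDual ![G.convMul φ ψ, χ] F = tensorDual ![φ, ψ, χ] (MvPowerSeries.subst
      (fun p : Fin 2 × Fin m => ![substPair G.series (slotVars R m (0 : Fin 3)) (slotVars R m 1),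
        slotVars R m 2] p.1 p.2) F) := by
  have hs : ∀ (i : Fin 3) (j : Fin m),
    MvPowerSeries.constantCoeff (slotVars R m i j) = 0 := by simp [slotVars]
  have hp := G.constantCoeff_substPair (hs 0) (hs 1)
  have h : ∀ p : Fin 2 × Fin m, MvPowerSeries.constantCoeff
      (![substPair G.series (slotVars R m (0 : Fin 3)) (slotVars R m 1),
        slotVars R m 2] p.1 p.2) = 0 := by
    rintro ⟨i, j⟩
    fin_cases i
    · exact hp j
    · exact hs 2 j
  have key := IsDegContinuous.ext_monomial (R := R) (tensorDual_continuous ![G.convMul φ ψ, χ])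
    ((tensorDual_continuous ![φ, ψ, χ]).comp_subst h) ?_
  · rw [key, LinearMap.comp_apply, substLin_apply]
  · intro d
    rw [tensorDual_monomial, LinearMap.comp_apply, substLin_apply, subst_monomial_one h,
      prod_pair_exp, ← subst_monomial_one hp, ← G.subst_comul (hs 0) (hs 1)]
    have h1 : ((expRow d 1).prod fun j k => slotVars R m (2 : Fin 3) j ^ k) =
        MvPowerSeries.monomial ((expRow d 1).mapDomain fun j => ((2 : Fin 3), j)) 1 := by
      rw [MvPowerSeries.monomial_mapDomain_apply_one]
      rfl
    have h2 : (fun p : Fin 2 × Fin m =>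
        ![slotVars R m (0 : Fin 3), slotVars R m 1] p.1 p.2) =
        fun p => MvPowerSeries.X (R := R) ((![0, 1] p.1 : Fin 3), p.2) := by
      funext ⟨i, j⟩
      fin_cases i <;> rfl
    rw [h1, h2, tensorDual_mul_slot _ ![0, 1] (by decide) 2 (by decide) (by decide),
      Fin.prod_univ_two]
    have h3 : (fun i => ![φ, ψ, χ] ((![0, 1] : Fin 2 → Fin 3) i)) = ![φ, ψ] := by
      funext i
      fin_cases i <;> rfl
    rw [h3]
    rfl

lemma tensorDual_convMul_right (φ ψ χ : contDual (Fin m) R)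
    (F : MvPowerSeries (Fin 2 × Fin m) R) :
    tensorDual ![φ, G.convMul ψ χ] F = tensorDual ![φ, ψ, χ] (MvPowerSeries.subst
      (fun p : Fin 2 × Fin m => ![slotVars R m (0 : Fin 3),
        substPair G.series (slotVars R m 1) (slotVars R m 2)] p.1 p.2) F) := by
  have hs : ∀ (i : Fin 3) (j : Fin m),
    MvPowerSeries.constantCoeff (slotVars R m i j) = 0 := by simp [slotVars]
  have hp := G.constantCoeff_substPair (hs 1) (hs 2)
  have h : ∀ p : Fin 2 × Fin m, MvPowerSeries.constantCoeff
      (![slotVars R m (0 : Fin 3),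
        substPair G.series (slotVars R m 1) (slotVars R m 2)] p.1 p.2) = 0 := by
    rintro ⟨i, j⟩
    fin_cases i
    · exact hs 0 j
    · exact hp j
  have key := IsDegContinuous.ext_monomial (R := R) (tensorDual_continuous ![φ, G.convMul ψ χ])
    ((tensorDual_continuous ![φ, ψ, χ]).comp_subst h) ?_
  · rw [key, LinearMap.comp_apply, substLin_apply]
  · intro d
    rw [tensorDual_monomial, LinearMap.comp_apply, substLin_apply, subst_monomial_one h,
      prod_pair_exp, ← subst_monomial_one hp, ← G.subst_comul (hs 1) (hs 2)]
    have h1 : ((expRow d 0).prod fun j k => slotVars R m (0 : Fin 3) j ^ k) =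
        MvPowerSeries.monomial ((expRow d 0).mapDomain fun j => ((0 : Fin 3), j)) 1 := by
      rw [MvPowerSeries.monomial_mapDomain_apply_one]
      rfl
    have h2 : (fun p : Fin 2 × Fin m =>
        ![slotVars R m (1 : Fin 3), slotVars R m 2] p.1 p.2) =
        fun p => MvPowerSeries.X (R := R) ((![1, 2] p.1 : Fin 3), p.2) := by
      funext ⟨i, j⟩
      fin_cases i <;> rfl
    rw [h1, h2, mul_comm, tensorDual_mul_slot _ ![1, 2] (by decide) 0 (by decide) (by decide),
      Fin.prod_univ_two, mul_comm]
    have h3 : (fun i => ![φ, ψ, χ] ((![1, 2] : Fin 2 → Fin 3) i)) = ![ψ, χ] := by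
      funext i
      fin_cases i <;> rfl
    rw [h3]
    rfl

lemma convMul_assoc (φ ψ χ : contDual (Fin m) R) :
    G.convMul (G.convMul φ ψ) χ = G.convMul φ (G.convMul ψ χ) := by
  have hs : ∀ (i : Fin 3) (j : Fin m),
    MvPowerSeries.constantCoeff (slotVars R m i j) = 0 := by simp [slotVars]
  ext f
  rw [convMul_apply, convMul_apply, tensorDual_convMul_left, tensorDual_convMul_right,
    G.subst_comul (G.constantCoeff_substPair (hs 0) (hs 1)) (hs 2),
    G.subst_comul (hs 0) (G.constantCoeff_substPair (hs 1) (hs 2)), G.assoc]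

end FormalGroupLaw

lemma IsDegContinuous.apply_eq_zero {σ R M : Type*} [Finite σ] [CommRing R] [AddCommGroup M]
    [Module R M] {φ : MvPowerSeries σ R →ₗ[R] M} (hφ : IsDegContinuous φ) {N : ℕ}
    (h : ∀ d : σ →₀ ℕ, N ≤ d.degree → φ (MvPowerSeries.monomial d 1) = 0)
    {f : MvPowerSeries σ R} (hf : f ∈ degFiltration σ R N) : φ f = 0 := by
  obtain ⟨K, hK⟩ := hφ.exists_sum
  rw [hK K le_rfl]
  refine Finset.sum_eq_zero fun d _ => ?_
  by_cases hd : d.degree < N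
  · rw [hf d hd, zero_smul]
  · rw [h d (not_lt.1 hd), smul_zero]

lemma subst_sub_mem {σ R : Type*} [Finite σ] [CommRing R] {h : σ → MvPowerSeries σ R}
    (h0 : ∀ i, MvPowerSeries.constantCoeff (h i) = 0)
    (h1 : ∀ i, h i - MvPowerSeries.X i ∈ degFiltration σ R 2) {N : ℕ} {f : MvPowerSeries σ R}
    (hf : f ∈ degFiltration σ R N) : substLin h h0 f - f ∈ degFiltration σ R (N + 1) := by
  classical
  have hmul : ∀ {a b : ℕ} {f g : MvPowerSeries σ R}, f ∈ degFiltration σ R a →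
      g ∈ degFiltration σ R b → f * g ∈ degFiltration σ R (a + b) := by
    intro a b f g hf hg
    rw [mem_degFiltration] at *
    push_cast
    exact (add_le_add hf hg).trans MvPowerSeries.le_order_mul
  have hmon : ∀ d : σ →₀ ℕ,
      MvPowerSeries.monomial d (1 : R) ∈ degFiltration σ R d.degree := by
    intro d e he
    rw [MvPowerSeries.coeff_monomial, if_neg]
    rintro rfl
    exact lt_irrefl _ he
  have hadd : ∀ d e : σ →₀ ℕ,
      substLin h h0 (MvPowerSeries.monomial d 1) - MvPowerSeries.monomial d 1 ∈
        degFiltration σ R (d.degree + 1) →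
      substLin h h0 (MvPowerSeries.monomial e 1) - MvPowerSeries.monomial e 1 ∈
        degFiltration σ R (e.degree + 1) →
      substLin h h0 (MvPowerSeries.monomial (d + e) 1) - MvPowerSeries.monomial (d + e) 1 ∈
        degFiltration σ R ((d + e).degree + 1) := by
    intro d e hd he
    have hm : MvPowerSeries.monomial (d + e) (1 : R) =
        MvPowerSeries.monomial d 1 * MvPowerSeries.monomial e 1 := by
      rw [MvPowerSeries.monomial_mul_monomial, one_mul]
    have hS : substLin h h0 (MvPowerSeries.monomial d 1 * MvPowerSeries.monomial e 1) =
        substLin h h0 (MvPowerSeries.monomial d 1) *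
          substLin h h0 (MvPowerSeries.monomial e 1) := by
      simp only [substLin_apply]
      exact MvPowerSeries.subst_mul (MvPowerSeries.hasSubst_of_constantCoeff_zero h0) _ _
    rw [hm, hS, map_add]
    have e1 := hmul (substLin_mem h0 (hmon d)) he
    have e2 := hmul hd (hmon e)
    rw [← add_assoc] at e1
    rw [add_right_comm] at e2
    convert (degFiltration σ R _).add_mem e1 e2 using 1
    ring
  have hzero : substLin h h0 (MvPowerSeries.monomial (0 : σ →₀ ℕ) (1 : R)) -
      MvPowerSeries.monomial 0 1 = 0 := by
    rw [substLin_apply, subst_monomial_one h0, Finsupp.prod_zero_index]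
    simp
  have hall : ∀ d : σ →₀ ℕ,
      substLin h h0 (MvPowerSeries.monomial d 1) - MvPowerSeries.monomial d 1 ∈
        degFiltration σ R (d.degree + 1) := by
    intro d
    induction d using Finsupp.induction_linear with
    | zero => rw [hzero]; exact Submodule.zero_mem _
    | add d e hd he => exact hadd d e hd he
    | single i k =>
      induction k with
      | zero => rw [Finsupp.single_zero, hzero]; exact Submodule.zero_mem _
      | succ k ih =>
        rw [Finsupp.single_add]
        refine hadd _ _ ih ?_
        rw [substLin_apply, subst_monomial_one h0, Finsupp.prod_single_index (by simp), pow_one,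
          Finsupp.degree_single]
        exact h1 i
  intro e he
  have hco : IsDegContinuous (MvPowerSeries.coeff (R := R) e ∘ₗ
      (substLin h h0 - LinearMap.id)) := by
    refine ⟨e.degree + 1, fun g hg => ?_⟩
    have := (degFiltration σ R _).sub_mem (substLin_mem h0 hg) hg
    exact this e (Nat.lt_succ_self _)
  exact hco.apply_eq_zero (N := N)
    (fun d hd => hall d e (lt_of_lt_of_le he (Nat.succ_le_succ hd))) hf

/-- Evaluation at zero, as a continuous functional. -/
noncomputable def evalZero (R : Type*) [CommRing R] (m : ℕ) : contDual (Fin m) R :=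
  ⟨MvPowerSeries.coeff 0, ⟨1, fun f hf => hf 0 (by simp)⟩⟩

lemma evalZero_monomial {R : Type*} [CommRing R] {m : ℕ} (d : Fin m →₀ ℕ) :
    (evalZero R m).1 (MvPowerSeries.monomial d 1) = d.prod fun _ k => (0 : R) ^ k := by
  classical
  change MvPowerSeries.coeff 0 (MvPowerSeries.monomial d (1 : R)) = _
  rw [MvPowerSeries.coeff_monomial]
  split_ifs with h
  · subst h; simp
  · obtain ⟨i, hi⟩ := Finsupp.ne_iff.1 (Ne.symm h)
    exact (Finset.prod_eq_zero (Finsupp.mem_support_iff.2 hi) (zero_pow hi)).symm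

lemma monomial_eq_prod_X {R : Type*} [CommRing R] {m : ℕ} (d : Fin m →₀ ℕ) :
    (d.prod fun j k => (MvPowerSeries.X j : MvPowerSeries (Fin m) R) ^ k) =
      MvPowerSeries.monomial d 1 := by
  rw [MvPowerSeries.monomial_one_eq]

lemma prod_zero_pow {R : Type*} [CommRing R] {m : ℕ} (d : Fin m →₀ ℕ) :
    (d.prod fun j k => ((0 : Fin m → MvPowerSeries (Fin m) R) j) ^ k) =
      (d.prod fun _ k => (0 : R) ^ k) • 1 := by
  by_cases h : d = 0
  · subst h; simp
  · obtain ⟨i, hi⟩ := Finsupp.ne_iff.1 h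
    rw [Finsupp.prod, Finset.prod_eq_zero (Finsupp.mem_support_iff.2 hi) (zero_pow hi),
      Finsupp.prod, Finset.prod_eq_zero (Finsupp.mem_support_iff.2 hi) (zero_pow hi), zero_smul]

lemma tensorDual_evalZero_left {R : Type*} [CommRing R] {m : ℕ} (φ : contDual (Fin m) R)
    (F : MvPowerSeries (Fin 2 × Fin m) R) :
    tensorDual ![evalZero R m, φ] F = φ.1 (MvPowerSeries.subst
      (fun p : Fin 2 × Fin m => ![0, MvPowerSeries.X] p.1 p.2) F) := by
  have h : ∀ p : Fin 2 × Fin m, MvPowerSeries.constantCoeff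
      (![(0 : Fin m → MvPowerSeries (Fin m) R), MvPowerSeries.X] p.1 p.2) = 0 := by
    rintro ⟨i, j⟩
    fin_cases i <;> simp
  have key := IsDegContinuous.ext_monomial (tensorDual_continuous ![evalZero R m, φ])
    (IsDegContinuous.comp_subst h φ.2) ?_
  · rw [key, LinearMap.comp_apply, substLin_apply]
  · intro d
    rw [tensorDual_monomial, LinearMap.comp_apply, substLin_apply, subst_monomial_one h,
      prod_pair_exp, monomial_eq_prod_X, prod_zero_pow, Fin.prod_univ_two, smul_mul_assoc,
      one_mul, map_smul, smul_eq_mul]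
    exact congrArg (· * _) (evalZero_monomial _)

lemma tensorDual_evalZero_right {R : Type*} [CommRing R] {m : ℕ} (φ : contDual (Fin m) R)
    (F : MvPowerSeries (Fin 2 × Fin m) R) :
    tensorDual ![φ, evalZero R m] F = φ.1 (MvPowerSeries.subst
      (fun p : Fin 2 × Fin m => ![MvPowerSeries.X, 0] p.1 p.2) F) := by
  have h : ∀ p : Fin 2 × Fin m, MvPowerSeries.constantCoeff
      (![MvPowerSeries.X, (0 : Fin m → MvPowerSeries (Fin m) R)] p.1 p.2) = 0 := by
    rintro ⟨i, j⟩
    fin_cases i <;> simp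
  have key := IsDegContinuous.ext_monomial (tensorDual_continuous ![φ, evalZero R m])
    (IsDegContinuous.comp_subst h φ.2) ?_
  · rw [key, LinearMap.comp_apply, substLin_apply]
  · intro d
    rw [tensorDual_monomial, LinearMap.comp_apply, substLin_apply, subst_monomial_one h,
      prod_pair_exp, monomial_eq_prod_X, prod_zero_pow, Fin.prod_univ_two, mul_smul_comm,
      mul_one, map_smul, smul_eq_mul, mul_comm]
    exact congrArg (· * _) (evalZero_monomial _)

namespace FormalGroupLaw

variable {R : Type*} [CommRing R] {m : ℕ} (G : FormalGroupLaw R m)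

lemma series_sub_mem (j : Fin m) :
    G.series j - (MvPowerSeries.X (0, j) + MvPowerSeries.X (1, j)) ∈
      degFiltration (Fin 2 × Fin m) R 2 := by
  classical
  obtain ⟨γ, hγ⟩ := G.low_degree
  intro d hd
  rw [map_sub, hγ j d (by omega), map_add, add_sub_cancel_left, map_sum]
  refine Finset.sum_eq_zero fun l _ => ?_
  rw [map_sum]
  refine Finset.sum_eq_zero fun k _ => ?_
  rw [mul_assoc, MvPowerSeries.coeff_C_mul, MvPowerSeries.X, MvPowerSeries.X,
    MvPowerSeries.monomial_mul_monomial, MvPowerSeries.coeff_monomial, if_neg, mul_zero]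
  rintro rfl
  simp at hd

lemma subst_eq_of_idem (h : Fin m → MvPowerSeries (Fin m) R)
    (h0 : ∀ i, MvPowerSeries.constantCoeff (h i) = 0)
    (h1 : ∀ i, h i - MvPowerSeries.X i ∈ degFiltration (Fin m) R 2)
    (hh : ∀ f, substLin h h0 (substLin h h0 f) = substLin h h0 f) (f : MvPowerSeries (Fin m) R) :
    substLin h h0 f = f := by
  rw [← sub_eq_zero]
  set g := substLin h h0 f - f with hg
  have hSg : substLin h h0 g = 0 := by rw [hg, map_sub, hh, sub_self]
  have hN : ∀ N, g ∈ degFiltration (Fin m) R N := by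
    intro N
    induction N with
    | zero => intro d hd; exact absurd hd (Nat.not_lt_zero _)
    | succ N ih =>
      have := subst_sub_mem h0 h1 ih
      rw [hSg, zero_sub] at this
      simpa using (degFiltration (Fin m) R (N + 1)).neg_mem this
  ext d
  exact hN (d.degree + 1) d (Nat.lt_succ_self _)

lemma convMul_evalZero_evalZero :
    G.convMul (evalZero R m) (evalZero R m) = evalZero R m := by
  ext f
  rw [convMul_apply, tensorDual_evalZero_left]
  have h : ∀ p : Fin 2 × Fin m, MvPowerSeries.constantCoeff
      (![(0 : Fin m → MvPowerSeries (Fin m) R), MvPowerSeries.X] p.1 p.2) = 0 := by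
    rintro ⟨i, j⟩
    fin_cases i <;> simp
  have key := IsDegContinuous.ext_monomial
    ((IsDegContinuous.comp_subst h (evalZero R m).2).comp_subst G.constantCoeff_series)
    (evalZero R m).2 ?_
  · have := DFunLike.congr_fun key f
    simpa only [LinearMap.comp_apply, substLin_apply, comul_apply] using this
  · intro d
    rw [LinearMap.comp_apply, LinearMap.comp_apply, substLin_apply _ _ (MvPowerSeries.monomial d 1),
      subst_monomial_one G.constantCoeff_series, evalZero_monomial, substLin_apply,
      ← MvPowerSeries.substAlgHom_apply (MvPowerSeries.hasSubst_of_constantCoeff_zero h)]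
    change MvPowerSeries.coeff 0 _ = _
    rw [MvPowerSeries.coeff_zero_eq_constantCoeff_apply, map_finsuppProd, map_finsuppProd]
    refine Finsupp.prod_congr fun j _ => ?_
    rw [map_pow, map_pow, MvPowerSeries.substAlgHom_apply,
      MvPowerSeries.constantCoeff_subst_eq_zero
        (MvPowerSeries.hasSubst_of_constantCoeff_zero h) h (G.constantCoeff_series j)]

lemma evalZero_convMul (φ : contDual (Fin m) R) : G.convMul (evalZero R m) φ = φ := by
  have hX : ∀ j, MvPowerSeries.constantCoeff (MvPowerSeries.X j : MvPowerSeries (Fin m) R) = 0 :=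
    by simp
  have hz : ∀ j, MvPowerSeries.constantCoeff
      ((0 : Fin m → MvPowerSeries (Fin m) R) j) = 0 := by simp
  have hp := G.constantCoeff_substPair hz hX
  have hT : ∀ (φ : contDual (Fin m) R) f, (G.convMul (evalZero R m) φ).1 f =
      φ.1 (substLin _ hp f) := by
    intro φ f
    rw [convMul_apply, tensorDual_evalZero_left, G.subst_comul hz hX, substLin_apply]
  have h : ∀ p : Fin 2 × Fin m, MvPowerSeries.constantCoeff
      (![(0 : Fin m → MvPowerSeries (Fin m) R), MvPowerSeries.X] p.1 p.2) = 0 := by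
    rintro ⟨i, j⟩
    fin_cases i <;> simp
  ext f
  rw [hT, subst_eq_of_idem _ hp]
  · intro j
    have := substLin_mem h (G.series_sub_mem j)
    simp only [map_sub, map_add, substLin_apply,
      MvPowerSeries.subst_X (MvPowerSeries.hasSubst_of_constantCoeff_zero h)] at this
    simpa [substPair] using this
  · intro f
    ext d
    let c : contDual (Fin m) R :=
      ⟨MvPowerSeries.coeff d, ⟨d.degree + 1, fun g hg => hg d (Nat.lt_succ_self _)⟩⟩
    have := G.convMul_assoc (evalZero R m) (evalZero R m) c
    rw [convMul_evalZero_evalZero] at this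
    have h2 := DFunLike.congr_fun (congrArg Subtype.val this) f
    rw [hT, hT, hT] at h2
    exact h2.symm

lemma convMul_evalZero (φ : contDual (Fin m) R) : G.convMul φ (evalZero R m) = φ := by
  have hX : ∀ j, MvPowerSeries.constantCoeff (MvPowerSeries.X j : MvPowerSeries (Fin m) R) = 0 :=
    by simp
  have hz : ∀ j, MvPowerSeries.constantCoeff
      ((0 : Fin m → MvPowerSeries (Fin m) R) j) = 0 := by simp
  have hp := G.constantCoeff_substPair hX hz
  have hT : ∀ (φ : contDual (Fin m) R) f, (G.convMul φ (evalZero R m)).1 f =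
      φ.1 (substLin _ hp f) := by
    intro φ f
    rw [convMul_apply, tensorDual_evalZero_right, G.subst_comul hX hz, substLin_apply]
  have h : ∀ p : Fin 2 × Fin m, MvPowerSeries.constantCoeff
      (![MvPowerSeries.X, (0 : Fin m → MvPowerSeries (Fin m) R)] p.1 p.2) = 0 := by
    rintro ⟨i, j⟩
    fin_cases i <;> simp
  ext f
  rw [hT, subst_eq_of_idem _ hp]
  · intro j
    have := substLin_mem h (G.series_sub_mem j)
    simp only [map_sub, map_add, substLin_apply,
      MvPowerSeries.subst_X (MvPowerSeries.hasSubst_of_constantCoeff_zero h)] at this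
    simpa [substPair] using this
  · intro f
    ext d
    let c : contDual (Fin m) R :=
      ⟨MvPowerSeries.coeff d, ⟨d.degree + 1, fun g hg => hg d (Nat.lt_succ_self _)⟩⟩
    have := G.convMul_assoc c (evalZero R m) (evalZero R m)
    rw [convMul_evalZero_evalZero] at this
    have h2 := DFunLike.congr_fun (congrArg Subtype.val this) f
    rw [hT, hT, hT] at h2
    exact h2

end FormalGroupLaw

lemma update_pair_zero {S : Type*} (a b x : S) : Function.update ![a, b] 0 x = ![x, b] := by
  funext i
  fin_cases i <;> simp

lemma update_pair_one {S : Type*} (a b x : S) : Function.update ![a, b] 1 x = ![a, x] := by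
  funext i
  fin_cases i <;> simp

namespace FormalGroupLaw

variable {R : Type*} [CommRing R] {m : ℕ}

/-- The continuous dual of the ring of functions of `G`, with the algebra structure dual to the
comultiplication of the ring of functions. -/
def Dist (_G : FormalGroupLaw R m) : Type _ := contDual (Fin m) R

variable (G : FormalGroupLaw R m)

noncomputable instance : AddCommGroup G.Dist := inferInstanceAs (AddCommGroup (contDual (Fin m) R))

noncomputable instance : Module R G.Dist := inferInstanceAs (Module R (contDual (Fin m) R))

lemma convMul_add (φ ψ χ : contDual (Fin m) R) :
    G.convMul φ (ψ + χ) = G.convMul φ ψ + G.convMul φ χ := by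
  ext f
  have h := tensorDual.map_update_add ![φ, 0] 1 ψ χ
  simp only [update_pair_one] at h
  exact DFunLike.congr_fun h (G.comul f)

lemma add_convMul (φ ψ χ : contDual (Fin m) R) :
    G.convMul (φ + ψ) χ = G.convMul φ χ + G.convMul ψ χ := by
  ext f
  have h := tensorDual.map_update_add ![0, χ] 0 φ ψ
  simp only [update_pair_zero] at h
  exact DFunLike.congr_fun h (G.comul f)

lemma convMul_smul (r : R) (φ ψ : contDual (Fin m) R) :
    G.convMul φ (r • ψ) = r • G.convMul φ ψ := by
  ext f
  have h := tensorDual.map_update_smul ![φ, 0] 1 r ψ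
  simp only [update_pair_one] at h
  exact DFunLike.congr_fun h (G.comul f)

lemma smul_convMul (r : R) (φ ψ : contDual (Fin m) R) :
    G.convMul (r • φ) ψ = r • G.convMul φ ψ := by
  ext f
  have h := tensorDual.map_update_smul ![0, ψ] 0 r φ
  simp only [update_pair_zero] at h
  exact DFunLike.congr_fun h (G.comul f)

noncomputable instance : Ring G.Dist where
  __ := (inferInstance : AddCommGroup G.Dist)
  mul φ ψ := G.convMul φ ψ
  one := evalZero R m
  mul_assoc := G.convMul_assoc
  one_mul := G.evalZero_convMul
  mul_one := G.convMul_evalZero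
  left_distrib := G.convMul_add
  right_distrib := G.add_convMul
  zero_mul φ := by
    have h := G.add_convMul 0 0 φ
    rw [add_zero] at h
    exact left_eq_add.1 h
  mul_zero φ := by
    have h := G.convMul_add φ 0 0
    rw [add_zero] at h
    exact left_eq_add.1 h

noncomputable instance : Algebra R G.Dist :=
  Algebra.ofModule (fun r φ ψ => G.smul_convMul r φ ψ) (fun r φ ψ => G.convMul_smul r φ ψ)

lemma dist_mul_def (φ ψ : G.Dist) : φ * ψ = G.convMul φ ψ := rfl

/-- The Lie algebra of `G`: the free module on `e_1, …, e_m`. -/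
def LieAlg (_G : FormalGroupLaw R m) : Type _ := Fin m → R

noncomputable instance : AddCommGroup G.LieAlg := inferInstanceAs (AddCommGroup (Fin m → R))

noncomputable instance : Module R G.LieAlg := inferInstanceAs (Module R (Fin m → R))

/-- The coefficient `γ_{lk}^j` of `X_l Y_k` in `G⁽ʲ⁾`. -/
noncomputable def structConst (j l k : Fin m) : R :=
  MvPowerSeries.coeff (Finsupp.single (0, l) 1 + Finsupp.single (1, k) 1) (G.series j)

/-- The bracket with `[e_l, e_k] = ∑_j (γ_{lk}^j - γ_{kl}^j) e_j`. -/
noncomputable instance : Bracket G.LieAlg G.LieAlg where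
  bracket x y := fun j => ∑ l, ∑ k, x l * y k * (G.structConst j l k - G.structConst j k l)

lemma lie_apply (x y : G.LieAlg) (j : Fin m) :
    (⁅x, y⁆ : G.LieAlg) j =
      ∑ l, ∑ k, x l * y k * (G.structConst j l k - G.structConst j k l) := rfl

/-- The differential `df ∈ Hom(𝔤, R)` of a function at the origin,
`df(∑ r_j e_j) = ∑ r_j ∂f/∂t_j (0)`. -/
noncomputable def differential (f : MvPowerSeries (Fin m) R) : Module.Dual R G.LieAlg where
  toFun x := ∑ j, x j * MvPowerSeries.constantCoeff (MvPowerSeries.pderiv R j f)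
  map_add' x y := by
    rw [← Finset.sum_add_distrib]
    exact Finset.sum_congr rfl fun j _ => add_mul _ _ _
  map_smul' r x := by
    rw [RingHom.id_apply, smul_eq_mul, Finset.mul_sum]
    exact Finset.sum_congr rfl fun j _ => mul_assoc _ _ _

lemma differential_apply (f : MvPowerSeries (Fin m) R) (x : G.LieAlg) :
    G.differential f x =
      ∑ j, x j * MvPowerSeries.constantCoeff (MvPowerSeries.pderiv R j f) := rfl

/-- The map `L ↦ [f ↦ L(f) = df(L)]` from `𝔤` to the continuous dual. -/
noncomputable def toDual : G.LieAlg →ₗ[R] contDual (Fin m) R where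
  toFun x := ⟨{
      toFun := fun f => G.differential f x
      map_add' := fun f g => by
        simp only [differential_apply, map_add, mul_add, Finset.sum_add_distrib]
      map_smul' := fun r f => by
        simp only [differential_apply, smul_eq_mul, RingHom.id_apply, Finset.mul_sum]
        refine Finset.sum_congr rfl fun j _ => ?_
        rw [Derivation.map_smul, MvPowerSeries.constantCoeff_smul, smul_eq_mul, mul_left_comm] },
    ⟨2, fun f hf => by
      simp only [LinearMap.coe_mk, AddHom.coe_mk, differential_apply]
      refine Finset.sum_eq_zero fun j _ => ?_
      rw [← MvPowerSeries.coeff_zero_eq_constantCoeff_apply, MvPowerSeries.coeff_pderiv,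
        hf _ (by simp), zero_mul, mul_zero]⟩⟩
  map_add' x y := by
    apply Subtype.ext
    ext f
    exact map_add (G.differential f) x y
  map_smul' r x := by
    apply Subtype.ext
    ext f
    exact map_smul (G.differential f) r x

lemma toDual_apply (x : G.LieAlg) (f : MvPowerSeries (Fin m) R) :
    (G.toDual x).1 f = G.differential f x := rfl

end FormalGroupLaw

/-- A continuous derivation at the origin is determined by its values on the variables. -/
lemma derivation_zero_ext {σ R : Type*} [Finite σ] [CommRing R]
    {δ δ' : MvPowerSeries σ R →ₗ[R] R} (hδ : IsDegContinuous δ) (hδ' : IsDegContinuous δ')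
    (h : ∀ f g, δ (f * g) =
      δ f * MvPowerSeries.constantCoeff g + MvPowerSeries.constantCoeff f * δ g)
    (h' : ∀ f g, δ' (f * g) =
      δ' f * MvPowerSeries.constantCoeff g + MvPowerSeries.constantCoeff f * δ' g)
    (hX : ∀ i, δ (MvPowerSeries.X i) = δ' (MvPowerSeries.X i)) : δ = δ' := by
  refine hδ.ext_monomial hδ' fun d => ?_
  have h1 : δ 1 = 0 := by simpa using h 1 1
  have h1' : δ' 1 = 0 := by simpa using h' 1 1
  have hz : MvPowerSeries.monomial (0 : σ →₀ ℕ) (1 : R) = 1 := rfl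
  have hadd : ∀ d e : σ →₀ ℕ, MvPowerSeries.monomial (d + e) (1 : R) =
      MvPowerSeries.monomial d 1 * MvPowerSeries.monomial e 1 := by
    intro d e
    rw [MvPowerSeries.monomial_mul_monomial, one_mul]
  induction d using Finsupp.induction_linear with
  | zero => rw [hz, h1, h1']
  | add d e hd he => rw [hadd, h, h', hd, he]
  | single i k =>
    induction k with
    | zero => rw [Finsupp.single_zero, hz, h1, h1']
    | succ k ih => rw [Finsupp.single_add, hadd, h, h', ih]; exact congrArg _ (congrArg _ (hX i))

namespace FormalGroupLaw

variable {R : Type*} [CommRing R] {m : ℕ} (G : FormalGroupLaw R m)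

lemma tensorDual_toDual (x y : G.LieAlg) (F : MvPowerSeries (Fin 2 × Fin m) R) :
    tensorDual ![G.toDual x, G.toDual y] F = ∑ l, ∑ k, x l * y k *
      MvPowerSeries.coeff (Finsupp.single (0, l) 1 + Finsupp.single (1, k) 1) F := by
  classical
  let ψ : MvPowerSeries (Fin 2 × Fin m) R →ₗ[R] R := ∑ l, ∑ k, (x l * y k) •
    MvPowerSeries.coeff (Finsupp.single (0, l) 1 + Finsupp.single (1, k) 1)
  have hψ : IsDegContinuous ψ := by
    refine ⟨3, fun f hf => ?_⟩
    simp only [ψ, LinearMap.sum_apply, LinearMap.smul_apply]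
    refine Finset.sum_eq_zero fun l _ => Finset.sum_eq_zero fun k _ => ?_
    rw [hf _ (by simp), smul_zero]
  have key := IsDegContinuous.ext_monomial
    (tensorDual_continuous ![G.toDual x, G.toDual y]) hψ ?_
  · have := DFunLike.congr_fun key F
    simpa [ψ] using this
  · intro d
    have hd : ∀ (z : G.LieAlg) (e : Fin m →₀ ℕ), (G.toDual z).1 (MvPowerSeries.monomial e 1) =
        ∑ l, if e = Finsupp.single l 1 then z l else 0 := by
      intro z e
      rw [toDual_apply, differential_apply]
      refine Finset.sum_congr rfl fun l _ => ?_
      rw [← MvPowerSeries.coeff_zero_eq_constantCoeff_apply, MvPowerSeries.coeff_pderiv,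
        MvPowerSeries.coeff_monomial]
      simp [eq_comm]
    have hiff : ∀ l k, (expRow d 0 = Finsupp.single l 1 ∧ expRow d 1 = Finsupp.single k 1) ↔
        Finsupp.single ((0 : Fin 2), l) 1 + Finsupp.single (1, k) 1 = d := by
      intro l k
      constructor
      · rintro ⟨h0, h1⟩
        rw [exp_eq_add d, h0, h1, Finsupp.mapDomain_single, Finsupp.mapDomain_single]
      · rintro rfl
        constructor <;>
        · ext j
          simp [expRow, Finsupp.single_apply]
    rw [tensorDual_monomial, Fin.prod_univ_two]
    change (G.toDual x).1 _ * (G.toDual y).1 _ = _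
    rw [hd, hd, Finset.sum_mul_sum]
    simp only [ψ, LinearMap.sum_apply, LinearMap.smul_apply, MvPowerSeries.coeff_monomial,
      smul_eq_mul]
    refine Finset.sum_congr rfl fun l _ => Finset.sum_congr rfl fun k _ => ?_
    have := hiff l k
    split_ifs <;> simp_all

lemma coeff_add_single (l k : Fin m) (F : MvPowerSeries (Fin 2 × Fin m) R) :
    MvPowerSeries.coeff (Finsupp.single (0, l) 1 + Finsupp.single (1, k) 1) F =
      MvPowerSeries.constantCoeff
        (MvPowerSeries.pderiv R (0, l) (MvPowerSeries.pderiv R (1, k) F)) := by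
  rw [← MvPowerSeries.coeff_zero_eq_constantCoeff_apply, MvPowerSeries.coeff_pderiv,
    MvPowerSeries.coeff_pderiv]
  simp

lemma comul_mul (f g : MvPowerSeries (Fin m) R) : G.comul (f * g) = G.comul f * G.comul g := by
  simp only [comul_apply]
  exact MvPowerSeries.subst_mul
    (MvPowerSeries.hasSubst_of_constantCoeff_zero G.constantCoeff_series) _ _

lemma constantCoeff_comul (f : MvPowerSeries (Fin m) R) :
    MvPowerSeries.constantCoeff (G.comul f) = MvPowerSeries.constantCoeff f := by
  have h2 : f - MvPowerSeries.C (MvPowerSeries.constantCoeff f) ∈ degFiltration (Fin m) R 1 := by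
    intro d hd
    have hd0 : d = 0 := (Finsupp.degree_eq_zero_iff d).1 (Nat.lt_one_iff.1 hd)
    subst hd0
    simp
  have h3 := substLin_mem G.constantCoeff_series h2 0 (by simp)
  have hC : substLin G.series G.constantCoeff_series
      (MvPowerSeries.C (MvPowerSeries.constantCoeff f)) =
      MvPowerSeries.C (MvPowerSeries.constantCoeff f) := by
    rw [substLin_apply, MvPowerSeries.subst_C]
  rw [map_sub, hC, map_sub, sub_eq_zero] at h3
  rw [MvPowerSeries.coeff_zero_eq_constantCoeff_apply,
    MvPowerSeries.coeff_zero_eq_constantCoeff_apply, MvPowerSeries.constantCoeff_C] at h3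
  exact h3

lemma constantCoeff_pderiv_comul (i : Fin 2) (l : Fin m) (f : MvPowerSeries (Fin m) R) :
    MvPowerSeries.constantCoeff (MvPowerSeries.pderiv R (i, l) (G.comul f)) =
      MvPowerSeries.constantCoeff (MvPowerSeries.pderiv R l f) := by
  classical
  have hc : ∀ {σ : Type} [Finite σ] (i : σ), IsDegContinuous
      (MvPowerSeries.coeff (R := R) 0 ∘ₗ (MvPowerSeries.pderiv R i).toLinearMap) := by
    intro σ _ i
    refine ⟨2, fun f hf => ?_⟩
    change MvPowerSeries.coeff 0 (MvPowerSeries.pderiv R i f) = 0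
    rw [MvPowerSeries.coeff_pderiv, hf _ (by simp), zero_mul]
  have key := derivation_zero_ext ((hc (i, l)).comp_subst G.constantCoeff_series) (hc l) ?_ ?_ ?_
  · exact DFunLike.congr_fun key f
  · intro f g
    change MvPowerSeries.constantCoeff (MvPowerSeries.pderiv R (i, l) (G.comul (f * g))) =
      MvPowerSeries.constantCoeff (MvPowerSeries.pderiv R (i, l) (G.comul f)) * _ +
      _ * MvPowerSeries.constantCoeff (MvPowerSeries.pderiv R (i, l) (G.comul g))
    rw [comul_mul, Derivation.leibniz]
    simp only [map_add, smul_eq_mul, map_mul, constantCoeff_comul]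
    ring
  · intro f g
    change MvPowerSeries.constantCoeff (MvPowerSeries.pderiv R l (f * g)) =
      MvPowerSeries.constantCoeff (MvPowerSeries.pderiv R l f) * _ +
      _ * MvPowerSeries.constantCoeff (MvPowerSeries.pderiv R l g)
    rw [Derivation.leibniz]
    simp only [map_add, smul_eq_mul, map_mul]
    ring
  · intro j
    change MvPowerSeries.coeff 0 (MvPowerSeries.pderiv R (i, l) (substLin _ _ _)) =
      MvPowerSeries.coeff 0 (MvPowerSeries.pderiv R l (MvPowerSeries.X j))
    rw [substLin_apply, MvPowerSeries.subst_X
      (MvPowerSeries.hasSubst_of_constantCoeff_zero G.constantCoeff_series),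
      MvPowerSeries.coeff_pderiv, MvPowerSeries.coeff_pderiv]
    have := G.series_sub_mem j (Finsupp.single (i, l) 1) (by simp)
    rw [map_sub, sub_eq_zero] at this
    rw [zero_add, this, map_add, MvPowerSeries.coeff_X, MvPowerSeries.coeff_X, zero_add,
      MvPowerSeries.coeff_X]
    fin_cases i <;> simp [Finsupp.single_left_inj]

lemma toDual_lie (x y : G.LieAlg) :
    G.toDual ⁅x, y⁆ =
      G.convMul (G.toDual x) (G.toDual y) - G.convMul (G.toDual y) (G.toDual x) := by
  apply Subtype.ext
  change _ = (G.convMul (G.toDual x) (G.toDual y)).1 - (G.convMul (G.toDual y) (G.toDual x)).1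
  refine derivation_zero_ext (G.toDual _).2
    ((contDual (Fin m) R).sub_mem (G.convMul _ _).2 (G.convMul _ _).2) ?_ ?_ ?_
  · intro f g
    simp only [toDual_apply, differential_apply, Finset.sum_mul, Finset.mul_sum]
    rw [← Finset.sum_add_distrib]
    refine Finset.sum_congr rfl fun l _ => ?_
    rw [Derivation.leibniz]
    simp only [map_add, smul_eq_mul, map_mul]
    ring
  · intro f g
    have hsw : ∀ F, tensorDual ![G.toDual y, G.toDual x] F = ∑ l, ∑ k, x l * y k *
        MvPowerSeries.coeff (Finsupp.single (0, k) 1 + Finsupp.single (1, l) 1) F := by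
      intro F
      rw [tensorDual_toDual, Finset.sum_comm]
      exact Finset.sum_congr rfl fun l _ => Finset.sum_congr rfl fun k _ => by ring
    simp only [LinearMap.sub_apply, convMul_apply, tensorDual_toDual G x y, hsw,
      ← Finset.sum_sub_distrib, Finset.sum_mul, Finset.mul_sum]
    rw [← Finset.sum_add_distrib]
    refine Finset.sum_congr rfl fun l _ => ?_
    rw [← Finset.sum_add_distrib]
    refine Finset.sum_congr rfl fun k _ => ?_
    simp only [coeff_add_single, comul_mul, Derivation.leibniz, map_add, smul_eq_mul, map_mul,
      constantCoeff_comul, constantCoeff_pderiv_comul]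
    ring
  · intro j
    have hX : G.comul (MvPowerSeries.X j) = G.series j := by
      rw [comul_apply, MvPowerSeries.subst_X
        (MvPowerSeries.hasSubst_of_constantCoeff_zero G.constantCoeff_series)]
    have hsw : ∀ F, tensorDual ![G.toDual y, G.toDual x] F = ∑ l, ∑ k, x l * y k *
        MvPowerSeries.coeff (Finsupp.single (0, k) 1 + Finsupp.single (1, l) 1) F := by
      intro F
      rw [tensorDual_toDual, Finset.sum_comm]
      exact Finset.sum_congr rfl fun l _ => Finset.sum_congr rfl fun k _ => by ring
    simp only [LinearMap.sub_apply, convMul_apply, tensorDual_toDual G x y, hsw, hX,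
      ← Finset.sum_sub_distrib]
    rw [toDual_apply, differential_apply, Finset.sum_eq_single j]
    · rw [MvPowerSeries.pderiv_X_self, map_one, mul_one, lie_apply]
      refine Finset.sum_congr rfl fun l _ => Finset.sum_congr rfl fun k _ => ?_
      simp only [structConst]
      ring
    · intro k _ hk
      rw [MvPowerSeries.pderiv_X_of_ne hk.symm, map_zero, mul_zero]
    · simp

lemma toDual_injective : Function.Injective G.toDual := by
  classical
  intro x y h
  funext j
  have := DFunLike.congr_fun (congrArg Subtype.val h) (MvPowerSeries.X j)
  have e : ∀ z : G.LieAlg, (G.toDual z).1 (MvPowerSeries.X j) = z j := by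
    intro z
    rw [toDual_apply, differential_apply, Finset.sum_eq_single j]
    · simp
    · intro k _ hk
      rw [MvPowerSeries.pderiv_X_of_ne hk.symm, map_zero, mul_zero]
    · simp
  rwa [e, e] at this

/-- The map `L ↦ [f ↦ L(f)]` from `𝔤` to the algebra `G.Dist`. -/
noncomputable def toDist : G.LieAlg →ₗ[R] G.Dist := G.toDual

lemma toDist_injective : Function.Injective G.toDist := G.toDual_injective

lemma toDist_lie (x y : G.LieAlg) :
    G.toDist ⁅x, y⁆ = G.toDist x * G.toDist y - G.toDist y * G.toDist x := G.toDual_lie x y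

noncomputable instance : LieRing G.LieAlg where
  add_lie x y z := G.toDist_injective (by simp only [toDist_lie, map_add]; noncomm_ring)
  lie_add x y z := G.toDist_injective (by simp only [toDist_lie, map_add]; noncomm_ring)
  lie_self x := G.toDist_injective (by simp only [toDist_lie, map_zero, sub_self])
  leibniz_lie x y z := G.toDist_injective (by simp only [toDist_lie, map_add]; noncomm_ring)

noncomputable instance : LieAlgebra R G.LieAlg where
  lie_smul r x y := G.toDist_injective (by
    simp only [toDist_lie, map_smul, mul_smul_comm, smul_mul_assoc, smul_sub])

end FormalGroupLaw

namespace FormalGroupLaw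

variable {R : Type*} [CommRing R] {m : ℕ} (G : FormalGroupLaw R m)

/-- The universal enveloping algebra of the Lie algebra of `G`. -/
abbrev Env : Type _ := UniversalEnvelopingAlgebra R G.LieAlg

attribute [local instance] LieRing.ofAssociativeRing in
/-- The algebra map `U(𝔤) → Dist` extending `L ↦ [f ↦ L(f)]`. -/
noncomputable def envToDist : G.Env →ₐ[R] G.Dist :=
  UniversalEnvelopingAlgebra.lift R
    { G.toDist with
      map_lie' := fun {x y} => by
        rw [LieRing.of_associative_ring_bracket]
        exact G.toDist_lie x y }

attribute [local instance] LieRing.ofAssociativeRing in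
/-- The counit `ε : U(𝔤) → R`, which is zero on `𝔤`. -/
noncomputable def counitAlg : G.Env →ₐ[R] R :=
  UniversalEnvelopingAlgebra.lift R (0 : G.LieAlg →ₗ⁅R⁆ R)

/-- The counit as a ring homomorphism. The trivial `U(𝔤)`-module `R` is `R` with the module
structure through this map, so that `Hom_{U(𝔤)}(M, R)` is `M →ₛₗ[G.counit] R`. -/
noncomputable def counit : G.Env →+* R := G.counitAlg.toRingHom

/-- The inhomogeneous cochains `K^n(G, R)`: the `n`-fold completed tensor power of the ring of
functions, i.e. power series in `n` groups of `m` variables. -/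
abbrev Cochain (_G : FormalGroupLaw R m) (n : ℕ) : Type _ := MvPowerSeries (Fin n × Fin m) R

/-- The cochains `C^n(𝔤, R) = Hom_R(⋀^n 𝔤, R)` of the Lie algebra of `G`. -/
abbrev LieCochain (n : ℕ) : Type _ := ⋀[R]^n G.LieAlg →ₗ[R] R

/-- The map `K^n(G, R) → Hom_R(U(𝔤)^{⊗ n}, R)` induced by the dual of `U(𝔤) → Dist`. -/
noncomputable def cochainToEnv (n : ℕ) : G.Cochain n →ₗ[R] (⨂[R]^n G.Env →ₗ[R] R) :=
  (PiTensorProduct.lift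
    ((tensorDual (n := n) (m := m) (R := R)).compLinearMap
      fun _ => (G.envToDist.toLinearMap : G.Env →ₗ[R] contDual (Fin m) R))).flip

lemma cochainToEnv_tprod (n : ℕ) (f : G.Cochain n) (u : Fin n → G.Env) :
    G.cochainToEnv n f (PiTensorProduct.tprod R u) =
      tensorDual (fun i => (G.envToDist (u i) : contDual (Fin m) R)) f := by
  simp [cochainToEnv]
  rfl

/-- The isomorphism `ι` from inhomogeneous to homogeneous cochains of `U(𝔤)`,
`φ ↦ [u₀ ⊗ w ↦ ε(u₀) φ(w)]`. -/
noncomputable def toHomogeneous (n : ℕ) :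
    (⨂[R]^n G.Env →ₗ[R] R) →ₗ[R] (G.Env ⊗[R] (⨂[R]^n G.Env) →ₛₗ[G.counit] R) where
  toFun φ :=
    { toFun := LinearMap.mul' R R ∘ₗ TensorProduct.map G.counitAlg.toLinearMap φ
      map_add' := map_add _
      map_smul' := fun u z => by
        induction z using TensorProduct.induction_on with
        | zero => simp
        | tmul v w =>
          simp [TensorProduct.smul_tmul', counit, mul_assoc]
        | add z z' h h' => rw [smul_add, map_add, map_add, h, h', smul_add] }
  map_add' φ ψ := by
    ext z
    simp [TensorProduct.map_add_right]
  map_smul' r φ := by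
    ext z
    simp [TensorProduct.map_smul_right]

attribute [local instance] LieRing.ofAssociativeRing in
/-- The anti-symmetrisation map `⋀^n 𝔤 → U(𝔤)^{⊗ n}`,
`x₁ ∧ ⋯ ∧ xₙ ↦ ∑_σ sgn(σ) x_{σ(1)} ⊗ ⋯ ⊗ x_{σ(n)}`. -/
noncomputable def antisymm (n : ℕ) : ⋀[R]^n G.LieAlg →ₗ[R] ⨂[R]^n G.Env :=
  PiTensorProduct.map (fun _ => (UniversalEnvelopingAlgebra.ι R : G.LieAlg →ₗ⁅R⁆ G.Env).toLinearMap)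
    ∘ₗ exteriorPower.toTensorPower R G.LieAlg n

/-- The map `ν` from homogeneous cochains of `U(𝔤)` to cochains of the Koszul complex
`V_n(𝔤) = U(𝔤) ⊗ ⋀^n 𝔤` induced by anti-symmetrisation. -/
noncomputable def toKoszul (n : ℕ) :
    (G.Env ⊗[R] (⨂[R]^n G.Env) →ₛₗ[G.counit] R) →ₗ[R]
      (G.Env ⊗[R] (⋀[R]^n G.LieAlg) →ₛₗ[G.counit] R) where
  toFun φ := φ.comp ((G.antisymm n).baseChange G.Env)
  map_add' _ _ := rfl
  map_smul' _ _ := rfl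

/-- The isomorphism `κ` from cochains of the Koszul complex to cochains of `𝔤`,
`φ ↦ [w ↦ φ(1 ⊗ w)]`. -/
noncomputable def koszulToLie (n : ℕ) :
    (G.Env ⊗[R] (⋀[R]^n G.LieAlg) →ₛₗ[G.counit] R) →ₗ[R] G.LieCochain n where
  toFun φ :=
    { toFun := fun w => φ (1 ⊗ₜ w)
      map_add' := fun w w' => by rw [TensorProduct.tmul_add, map_add]
      map_smul' := fun r w => by
        have h : (1 : G.Env) ⊗ₜ[R] (r • w) = algebraMap R G.Env r • ((1 : G.Env) ⊗ₜ[R] w) := by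
          rw [TensorProduct.tmul_smul, algebraMap_smul]
        rw [h, LinearMap.map_smulₛₗ]
        simp [counit] }
  map_add' _ _ := rfl
  map_smul' _ _ := rfl

/-- The map `φ^n : K^n(G, R) → C^n(𝔤, R)`, the composition of the map induced by `U(𝔤) → Dist`
with `ι`, `ν` and `κ`. -/
noncomputable def phi (n : ℕ) : G.Cochain n →ₗ[R] G.LieCochain n :=
  G.koszulToLie n ∘ₗ G.toKoszul n ∘ₗ G.toHomogeneous n ∘ₗ G.cochainToEnv n

/-- The `i`-th coface `K^n(G, R) → K^{n+1}(G, R)`: for `i = 0` it is `f(t₂, …, t_{n+1})`, for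
`1 ≤ i ≤ n` it is `f(t₁, …, G(t_i, t_{i+1}), …, t_{n+1})`, and for `i = n + 1` it is
`f(t₁, …, t_n)`. -/
noncomputable def coface (n : ℕ) (i : Fin (n + 2)) (f : G.Cochain n) : G.Cochain (n + 1) :=
  MvPowerSeries.subst (fun p : Fin n × Fin m =>
    if p.1.val + 1 < i.val then slotVars R m p.1.castSucc p.2
    else if p.1.val + 1 = i.val then
      substPair G.series (slotVars R m p.1.castSucc) (slotVars R m p.1.succ) p.2
    else slotVars R m p.1.succ p.2) f

/-- The differential `∂ = ∑ (-1)^i ∂^i` of the complex of inhomogeneous cochains. -/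
noncomputable def coboundary (n : ℕ) (f : G.Cochain n) : G.Cochain (n + 1) :=
  ∑ i : Fin (n + 2), (-1) ^ i.val • G.coface n i f

/-- The tuple `([x_r, x_s], x_0, …, x_n)` with `x_r` and `x_s` omitted, for `r < s`. -/
noncomputable def bracketTuple {n : ℕ} (x : Fin (n + 1) → G.LieAlg) (r s : Fin (n + 1)) :
    Fin n → G.LieAlg :=
  fun i => if i.val = 0 then ⁅x r, x s⁆
    else if i.val ≤ r.val then x ⟨i.val - 1, by omega⟩
    else if i.val < s.val then x i.castSucc
    else x i.succ

/-- The value on `x_0 ∧ ⋯ ∧ x_n` of the differential `∂'ω` of a cochain `ω` of `𝔤`,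
`∑_{r < s} (-1)^{r+s} ω([x_r, x_s] ∧ x_0 ∧ ⋯ ∧ x_n)_{r,s}`. -/
noncomputable def lieCoboundary {n : ℕ} (ω : G.LieCochain n) (x : Fin (n + 1) → G.LieAlg) : R :=
  ∑ r : Fin (n + 1), ∑ s : Fin (n + 1), if r < s then
    (-1) ^ (r.val + s.val) * ω (exteriorPower.ιMulti R n (G.bracketTuple x r s)) else 0

/-- The element `f₁ ⊗ ⋯ ⊗ fₙ` of `K^n(G, R)`, i.e. the product of the `f_i(t_i)`. -/
noncomputable def pureTensor {n : ℕ} (f : Fin n → MvPowerSeries (Fin m) R) : G.Cochain n :=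
  ∏ i, MvPowerSeries.subst (slotVars R m i) (f i)

/-- `df₁ ∧ ⋯ ∧ dfₙ` as an element of `C^n(𝔤, R)`, i.e. the cochain
`x₁ ∧ ⋯ ∧ xₙ ↦ det (df_i(x_j))`. -/
noncomputable def wedgeDifferential {n : ℕ} (f : Fin n → MvPowerSeries (Fin m) R) :
    G.LieCochain n :=
  exteriorPower.pairingDual R G.LieAlg n
    (exteriorPower.ιMulti R n fun i => G.differential (f i))

/-- The base change of a formal group law along a ring homomorphism. -/
noncomputable def map {S : Type*} [CommRing S] (h : R →+* S) : FormalGroupLaw S m where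
  series j := MvPowerSeries.map h (G.series j)
  low_degree := by
    obtain ⟨γ, hγ⟩ := G.low_degree
    refine ⟨fun j l k => h (γ j l k), fun j d hd => ?_⟩
    rw [MvPowerSeries.coeff_map, hγ j d hd, ← MvPowerSeries.coeff_map]
    simp
  assoc := by
    have hs : ∀ (i : Fin 3) (j : Fin m),
      MvPowerSeries.constantCoeff (slotVars R m i j) = 0 := by simp [slotVars]
    have hm : ∀ a b : Fin m → MvPowerSeries (Fin 3 × Fin m) R,
        (∀ j, MvPowerSeries.constantCoeff (a j) = 0) →
        (∀ j, MvPowerSeries.constantCoeff (b j) = 0) →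
        substPair (fun j => MvPowerSeries.map h (G.series j))
          (fun j => MvPowerSeries.map h (a j)) (fun j => MvPowerSeries.map h (b j)) =
        fun j => MvPowerSeries.map h (substPair G.series a b j) := by
      intro a b ha hb
      have hc : ∀ p : Fin 2 × Fin m, MvPowerSeries.constantCoeff (![a, b] p.1 p.2) = 0 := by
        rintro ⟨i, j⟩
        fin_cases i <;> simp [ha, hb]
      funext j
      rw [substPair, substPair, MvPowerSeries.map_subst
        (MvPowerSeries.hasSubst_of_constantCoeff_zero hc)]
      congr 1
      funext ⟨i, j⟩
      fin_cases i <;> rfl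
    have hv : ∀ i : Fin 3, slotVars S m i = fun j => MvPowerSeries.map h (slotVars R m i j) := by
      intro i
      funext j
      simp [slotVars]
    rw [hv, hv, hv, hm _ _ (hs 0) (hs 1), hm _ _ (hs 1) (hs 2),
      hm _ _ (G.constantCoeff_substPair (hs 0) (hs 1)) (hs 2),
      hm _ _ (hs 0) (G.constantCoeff_substPair (hs 1) (hs 2)), G.assoc]

end FormalGroupLaw

/-- The function `f` on `Kⁿᵐ` is given near the origin by the convergent power series `F`. -/
def IsExpansionAtZero {σ K : Type*} [Fintype σ] [NormedField K] (f : (σ → K) → K)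
    (F : MvPowerSeries σ K) : Prop :=
  ∀ᶠ z in nhds (0 : σ → K),
    HasSum (fun d : σ →₀ ℕ => MvPowerSeries.coeff d F * ∏ i, z i ^ d i) (f z)

namespace FormalGroupLaw

variable {K : Type*} [NontriviallyNormedField K] {m : ℕ} (G : FormalGroupLaw K m)

/-- A tangent vector at the origin in the `i`-th of `n` factors `K^m`. -/
noncomputable def slotVector {n : ℕ} (i : Fin n) : G.LieAlg →ₗ[K] (Fin n × Fin m → K) where
  toFun x p := if p.1 = i then x p.2 else 0
  map_add' x y := by
    funext p
    by_cases h : p.1 = i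
    · simp only [h, if_true, Pi.add_apply]; rfl
    · simp [h]
  map_smul' r x := by
    funext p
    by_cases h : p.1 = i
    · simp only [h, if_true, Pi.smul_apply, RingHom.id_apply]; rfl
    · simp [h]

/-- Differentiation of an analytic cochain `f(z₁, …, zₙ)`, `z_i ∈ K^m`, at the identity:
`x₁ ∧ ⋯ ∧ xₙ ↦ ∑_σ sgn(σ) ∂^n f (0) / ∂x_{σ(1)} ⋯ ∂x_{σ(n)}`, where `x_{σ(i)}` is a direction in
the `i`-th factor. For `f = f₁(z₁) ⋯ fₙ(zₙ)` this is `df₁ ∧ ⋯ ∧ dfₙ`. -/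
noncomputable def analyticDiff {n : ℕ} (f : (Fin n × Fin m → K) → K) : G.LieCochain n :=
  exteriorPower.alternatingMapLinearEquiv (MultilinearMap.alternatization
    ((iteratedFDeriv K n f 0).toMultilinearMap.compLinearMap fun i => G.slotVector i))

end FormalGroupLaw

/-! Since the counit sends 1 to 1, the composite of `ι`, `ν` and `κ` unwinds to an alternation: the
value of `φ^n(f)` on `x₁ ∧ ⋯ ∧ xₙ` is the signed sum over `σ` of `(x_{σ(1)} ⊗ ⋯ ⊗ x_{σ(n)})(f)`,
where each tangent vector acts on its own group of variables as a derivative at the origin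
(`phi_ιMulti`). All four claims are read off this formula.

Morphism of complexes: evaluate `∂f` on tangent vectors. The two outer cofaces omit a group of
variables and vanish, since a derivation kills constants. An inner coface composes one slot with the
comultiplication, so pairing with it multiplies two neighbouring functionals in the convolution
algebra (`evalTensor_coface`). Under alternation, exchanging these two factors costs a sign, so
twice the alternating sum is an alternating sum of commutators, and commutators of tangent vectors
are their Lie brackets (`two_mul_sum_sign_mergeAt`). Grouping permutations by their value at 0 and
moving the bracket to the front produces `∂'`, with each pair `r < s` met twice
(`sum_sign_update_bracket`, `sum_alternating_update_bracket`). Both sides thus agree after doubling,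
and 2 cancels in a domain of characteristic zero.

Continuity, values, uniqueness: a tangent vector reads only linear coefficients, so `φ^n(f)` depends
only on coefficients of total degree `n` (`evalTensor_toDist_eq_zero`). On a pure tensor the
alternation is the Leibniz expansion of a determinant (`phi_pureTensor`). Every monomial is a pure
tensor, and a continuous linear map is determined by its values on monomials.

Analytic comparison: a convergent power series is rewritten as a formal multilinear series, whose
`n`-th derivative at 0 is the sum of its degree `n` term over all orderings of the arguments. For
arguments supported in distinct groups of variables at most one ordering contributes to each
monomial (`sum_perm_slotVector`), and the result is again `(x₁ ⊗ ⋯ ⊗ xₙ)(F)`. -/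

/-! ### Alternating sums of products of neighbouring entries -/

open Equiv in
/-- Summation over permutations of `Fin (n + 1)`, grouped by the value at `0`. -/
lemma sum_perm_succ {n : ℕ} {A : Type*} [AddCommMonoid A] (g : Perm (Fin (n + 1)) → A) :
    ∑ σ, g σ = ∑ r : Fin (n + 1), ∑ ρ : Perm (Fin n),
      g (r.cycleRange.symm * Perm.decomposeFin.symm (0, ρ)) := by
  rw [← Finset.sum_product', Finset.univ_product_univ]
  symm
  refine Fintype.sum_bijective
    (fun q : Fin (n + 1) × Perm (Fin n) => q.1.cycleRange.symm * Perm.decomposeFin.symm (0, q.2))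
    ?_ _ _ fun _ => rfl
  -- The cardinalities agree through `decomposeFin`, so injectivity suffices; `r` is recovered as
  -- the value at 0.
  rw [Fintype.bijective_iff_injective_and_card]
  refine ⟨?_, Fintype.card_congr Perm.decomposeFin.symm⟩
  rintro ⟨r, ρ⟩ ⟨r', ρ'⟩ h
  have h0 := DFunLike.congr_fun h 0
  simp only [Perm.mul_apply, Perm.decomposeFin_symm_apply_zero, Fin.cycleRange_symm_zero] at h0
  subst h0
  simpa using h

/-- The tuple of length `n` in which the entries at `i` and `i + 1` are multiplied. -/
def mergeAt {D : Type*} [Mul D] {n : ℕ} (i : Fin n) (y : Fin (n + 1) → D) : Fin n → D :=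
  fun k => if k < i then y k.castSucc else if k = i then y i.castSucc * y i.succ else y k.succ

/-- The cycle sends `i` to 0 and shifts smaller indices up by one. After it, the left factor of the
product is always `y 0` and the other entries form the tail of `y`, a normal form that treats all
`i` alike. -/
lemma mergeAt_comp_cycleRange {D : Type*} [Mul D] {n : ℕ} (i : Fin n) (y : Fin (n + 1) → D) :
    mergeAt i (fun k => y (i.castSucc.cycleRange k)) =
      Function.update (fun k : Fin n => y k.succ) i (y 0 * y i.succ) := by
  funext k
  rcases lt_trichotomy k i with h | rfl | h
  · rw [mergeAt, if_pos h, Function.update_of_ne h.ne]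
    congr 1
    rw [Fin.cycleRange_of_lt (Fin.castSucc_lt_castSucc_iff.2 h), Fin.coeSucc_eq_succ]
  · simp [mergeAt, Fin.cycleRange_of_gt]
  · rw [mergeAt, if_neg h.not_gt, if_neg h.ne', Function.update_of_ne h.ne']
    rw [Fin.cycleRange_of_gt]
    exact Fin.castSucc_lt_succ.trans (Fin.succ_lt_succ_iff.2 h)

section Alternation

open Equiv

variable {R D L : Type*} [CommRing R] [Ring D] [Algebra R D] [LieRing L] [LieAlgebra R L] {n : ℕ}
  (M : MultilinearMap R (fun _ : Fin n => D) R) (δ : L →ₗ[R] D)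

/-- Right multiplication by the cycle is a bijection of the symmetric group, and the cycle has sign
`(-1)^i`. -/
lemma sum_sign_mergeAt (i : Fin n) (y : Fin (n + 1) → D) :
    ∑ σ : Perm (Fin (n + 1)), Perm.sign σ • M (mergeAt i fun k => y (σ k)) =
      (-1) ^ i.val * ∑ σ : Perm (Fin (n + 1)), Perm.sign σ •
        M (Function.update (fun k : Fin n => y (σ k.succ)) i (y (σ 0) * y (σ i.succ))) := by
  rw [← Equiv.sum_comp (Equiv.mulRight i.castSucc.cycleRange), Finset.mul_sum]
  refine Finset.sum_congr rfl fun σ _ => ?_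
  have := mergeAt_comp_cycleRange i fun k => y (σ k)
  simp only [Equiv.coe_mulRight, Perm.mul_apply, this, Perm.sign_mul, Fin.sign_cycleRange]
  simp only [Units.smul_def, zsmul_eq_mul]
  push_cast
  simp
  ring

/-- Right multiplication by the transposition of 0 and `i + 1` exchanges the two factors of the
product and fixes all other entries. -/
lemma sum_sign_update_swap (i : Fin n) (y : Fin (n + 1) → D) :
    ∑ σ : Perm (Fin (n + 1)), Perm.sign σ •
        M (Function.update (fun k : Fin n => y (σ k.succ)) i (y (σ 0) * y (σ i.succ))) =
      -∑ σ : Perm (Fin (n + 1)), Perm.sign σ •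
        M (Function.update (fun k : Fin n => y (σ k.succ)) i (y (σ i.succ) * y (σ 0))) := by
  rw [← Equiv.sum_comp (Equiv.mulRight (swap 0 i.succ)), ← Finset.sum_neg_distrib]
  refine Finset.sum_congr rfl fun σ _ => ?_
  simp only [Equiv.coe_mulRight, Perm.mul_apply, swap_apply_left, swap_apply_right,
    Perm.sign_mul, Perm.sign_swap (Fin.succ_ne_zero i).symm, mul_neg, mul_one, Units.neg_smul]
  congr 3
  funext k
  by_cases h : k = i
  · subst h; simp
  · rw [Function.update_of_ne h, Function.update_of_ne h,
      swap_apply_of_ne_of_ne (Fin.succ_ne_zero k) (by simpa using h)]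

/-- The two orders of the product have opposite alternating sums, so doubling one gives the
alternating sum of their difference. That difference is a commutator, hence the image of a bracket.
The factor 2 stays because 2 need not be invertible in `R`. -/
lemma two_mul_sum_sign_mergeAt (hδ : ∀ x y, δ ⁅x, y⁆ = δ x * δ y - δ y * δ x) (i : Fin n)
    (x : Fin (n + 1) → L) :
    2 * ∑ σ : Perm (Fin (n + 1)), Perm.sign σ • M (mergeAt i fun k => δ (x (σ k))) =
      (-1) ^ i.val * ∑ σ : Perm (Fin (n + 1)), Perm.sign σ •
        M.compLinearMap (fun _ => δ)
          (Function.update (fun k : Fin n => x (σ k.succ)) i ⁅x (σ 0), x (σ i.succ)⁆) := by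
  have h1 := sum_sign_mergeAt M i fun k => δ (x k)
  have h2 := sum_sign_update_swap M i fun k => δ (x k)
  have h3 : ∀ σ : Perm (Fin (n + 1)), M.compLinearMap (fun _ => δ)
      (Function.update (fun k : Fin n => x (σ k.succ)) i ⁅x (σ 0), x (σ i.succ)⁆) =
      M (Function.update (fun k => δ (x (σ k.succ))) i (δ (x (σ 0)) * δ (x (σ i.succ)))) -
      M (Function.update (fun k => δ (x (σ k.succ))) i (δ (x (σ i.succ)) * δ (x (σ 0)))) := by
    intro σ
    rw [← M.map_update_sub, ← hδ, MultilinearMap.compLinearMap_apply]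
    congr 1
    funext k
    by_cases h : k = i
    · subst h; simp
    · simp [Function.update_of_ne h]
  simp only [h3, smul_sub, Finset.sum_sub_distrib]
  rw [h1]
  linear_combination (-1) ^ i.val * h2

/-- Put `r = σ 0`. The rest of `σ` is a permutation `ρ` of the other indices, with sign `(-1)^r`
times that of `σ`, and the sum over `ρ` is an alternatization on the tuple without `x r`. -/
lemma sum_sign_update_bracket (N : MultilinearMap R (fun _ : Fin n => L) R) (x : Fin (n + 1) → L) :
    ∑ i : Fin n, ∑ σ : Perm (Fin (n + 1)), Perm.sign σ •
        N (Function.update (fun k : Fin n => x (σ k.succ)) i ⁅x (σ 0), x (σ i.succ)⁆) =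
      ∑ r : Fin (n + 1), ∑ j : Fin n, (-1) ^ r.val * MultilinearMap.alternatization N
        (Function.update (r.removeNth x) j ⁅x r, x (r.succAbove j)⁆) := by
  rw [Finset.sum_comm, sum_perm_succ]
  refine Finset.sum_congr rfl fun r _ => ?_
  simp only [MultilinearMap.alternatization_apply, MultilinearMap.domDomCongr_apply,
    Finset.mul_sum]
  conv_rhs => rw [Finset.sum_comm]
  refine Finset.sum_congr rfl fun ρ _ => ?_
  -- The bracket sits in slot `i` before `ρ` is undone and in slot `ρ i` after, so for fixed `ρ` the
  -- sum over `j` is reindexed by `j = ρ i`.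
  rw [← Equiv.sum_comp ρ fun j => (-1 : R) ^ r.val * (Perm.sign ρ •
    N fun k => Function.update (r.removeNth x) j ⁅x r, x (r.succAbove j)⁆ (ρ k))]
  refine Finset.sum_congr rfl fun i _ => ?_
  simp only [Perm.mul_apply, Perm.decomposeFin_symm_apply_zero, Fin.cycleRange_symm_zero,
    Perm.decomposeFin_symm_apply_succ, swap_self, Equiv.refl_apply, Fin.cycleRange_symm_succ,
    Perm.sign_mul, Perm.sign_symm, Fin.sign_cycleRange, Perm.decomposeFin.symm_sign, if_true]
  have : (fun k => Function.update (r.removeNth x) (ρ i) ⁅x r, x (r.succAbove (ρ i))⁆ (ρ k)) =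
      Function.update (fun k => x (r.succAbove (ρ k))) i ⁅x r, x (r.succAbove (ρ i))⁆ := by
    funext k
    by_cases h : k = i
    · subst h; simp
    · rw [Function.update_of_ne h, Function.update_of_ne (by simpa using h)]
      rfl
  rw [this]
  simp only [Units.smul_def, zsmul_eq_mul]
  push_cast
  ring

/-- An entry inserted in slot `j` reaches the front through a cycle of sign `(-1)^j`. -/
lemma alternating_update (A : L [⋀^Fin (n + 1)]→ₗ[R] R) (z : Fin (n + 1) → L) (j : Fin (n + 1))
    (w : L) : A (Function.update z j w) =
      (-1) ^ j.val * A (Fin.cons w (j.removeNth z)) := by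
  rw [← Fin.insertNth_removeNth, ← Fin.cons_comp_cycleRange, A.map_perm, Fin.sign_cycleRange]
  simp [Units.smul_def]

end Alternation

/-! ### Signs and indices in the Lie algebra differential -/

namespace FormalGroupLaw

variable {R : Type*} [CommRing R] {m : ℕ} (G : FormalGroupLaw R m)

/-- The index `j` counts positions after `r` is removed. When the second removed index lies above
`r` it is therefore `j + 1`. -/
lemma cons_bracket_removeNth {n : ℕ} (x : Fin (n + 2) → G.LieAlg) (r : Fin (n + 2))
    (j : Fin (n + 1)) (h : r < r.succAbove j) :
    Fin.cons ⁅x r, x (r.succAbove j)⁆ (j.removeNth (r.removeNth x)) =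
      G.bracketTuple x r (r.succAbove j) := by
  have hj : r ≤ j.castSucc := by
    by_contra hlt
    rw [Fin.succAbove_of_castSucc_lt _ _ (not_le.1 hlt)] at h
    exact hlt h.le
  rw [Fin.succAbove_of_le_castSucc _ _ hj]
  funext k
  refine Fin.cases ?_ (fun k => ?_) k
  · simp [bracketTuple]
  · rw [Fin.cons_succ, bracketTuple, if_neg (by simp), Fin.removeNth_apply, Fin.removeNth_apply]
    have hj' : r.val ≤ j.val := hj
    simp only [Fin.val_succ]
    split_ifs with h1 h2
    · congr 1
      rw [Fin.ext_iff]
      simp only [Fin.succAbove, Fin.lt_def, Fin.val_castSucc]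
      split_ifs <;> simp only [Fin.val_castSucc, Fin.val_succ] at * <;> omega
    · congr 1
      rw [Fin.ext_iff]
      simp only [Fin.succAbove, Fin.lt_def, Fin.val_castSucc, Fin.val_succ]
      split_ifs <;> simp only [Fin.val_castSucc, Fin.val_succ] at * <;> omega
    · congr 1
      rw [Fin.ext_iff]
      simp only [Fin.succAbove, Fin.lt_def, Fin.val_castSucc, Fin.val_succ]
      split_ifs <;> simp only [Fin.val_castSucc, Fin.val_succ] at * <;> omega

/-- Here the second removed index lies below `r` and equals `j`, so it takes the first place in the
bracket. -/
lemma cons_bracket_removeNth' {n : ℕ} (x : Fin (n + 2) → G.LieAlg) (r : Fin (n + 2))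
    (j : Fin (n + 1)) (h : r.succAbove j < r) :
    Fin.cons ⁅x (r.succAbove j), x r⁆ (j.removeNth (r.removeNth x)) =
      G.bracketTuple x (r.succAbove j) r := by
  have hj : j.castSucc < r := by
    by_contra hlt
    rw [Fin.succAbove_of_le_castSucc _ _ (not_lt.1 hlt)] at h
    exact hlt (Fin.castSucc_lt_succ.trans h)
  rw [Fin.succAbove_of_castSucc_lt _ _ hj]
  funext k
  refine Fin.cases ?_ (fun k => ?_) k
  · simp [bracketTuple]
  · rw [Fin.cons_succ, bracketTuple, if_neg (by simp), Fin.removeNth_apply, Fin.removeNth_apply]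
    have hj' : j.val < r.val := hj
    simp only [Fin.val_succ]
    split_ifs with h1 h2
    · congr 1
      rw [Fin.ext_iff]
      simp only [Fin.succAbove, Fin.lt_def, Fin.val_castSucc]
      split_ifs <;> simp only [Fin.val_castSucc, Fin.val_succ] at * <;> omega
    · congr 1
      rw [Fin.ext_iff]
      simp only [Fin.succAbove, Fin.lt_def, Fin.val_castSucc, Fin.val_succ]
      split_ifs <;> simp only [Fin.val_castSucc, Fin.val_succ] at * <;> omega
    · congr 1
      rw [Fin.ext_iff]
      simp only [Fin.succAbove, Fin.lt_def, Fin.val_castSucc, Fin.val_succ]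
      split_ifs <;> simp only [Fin.val_castSucc, Fin.val_succ] at * <;> omega

/-- Each pair of distinct indices occurs once in either order. If `r < s`, then `s = j + 1` turns
`(-1)^(r+j)` into `-(-1)^(r+s)`. If `s < r`, then `s = j` and the sign comes from the skew symmetry
of the bracket. Both cases absorb the leading minus. -/
lemma sum_alternating_update_bracket {n : ℕ} (A : G.LieAlg [⋀^Fin n]→ₗ[R] R)
    (x : Fin (n + 1) → G.LieAlg) :
    -∑ r : Fin (n + 1), ∑ j : Fin n, (-1) ^ r.val *
        A (Function.update (r.removeNth x) j ⁅x r, x (r.succAbove j)⁆) =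
      2 * ∑ r : Fin (n + 1), ∑ s : Fin (n + 1),
        if r < s then (-1) ^ (r.val + s.val) * A (G.bracketTuple x r s) else 0 := by
  cases n with
  | zero => simp
  | succ n =>
    set t : Fin (n + 2) → Fin (n + 2) → R := fun r s =>
      if r < s then (-1) ^ (r.val + s.val) * A (G.bracketTuple x r s) else 0 with ht
    -- Doubling turns the sum over `r < s` into a sum over all ordered pairs, which can be compared
    -- term by term.
    have h2 : 2 * ∑ r, ∑ s, t r s = ∑ r, ∑ s, (t r s + t s r) := by
      simp only [Finset.sum_add_distrib]
      rw [two_mul]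
      congr 1
      exact Finset.sum_comm
    rw [h2, ← Finset.sum_neg_distrib]
    refine Finset.sum_congr rfl fun r _ => ?_
    rw [Fin.sum_univ_succAbove _ r, ← Finset.sum_neg_distrib]
    simp only [ht, lt_self_iff_false, if_false, add_zero, zero_add]
    refine Finset.sum_congr rfl fun j _ => ?_
    rw [alternating_update]
    rcases lt_or_gt_of_ne (Fin.succAbove_ne r j) with h | h
    · rw [if_neg h.not_gt, if_pos h, zero_add, ← cons_bracket_removeNth' G x r j h,
        ← lie_skew]
      have hs : (r.succAbove j).val = j.val := by
        rw [Fin.succAbove_lt_iff_castSucc_lt] at h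
        rw [Fin.succAbove_of_castSucc_lt _ _ h, Fin.val_castSucc]
      have := A.map_update_neg (Fin.cons ⁅x (r.succAbove j), x r⁆ (j.removeNth (r.removeNth x)))
        0 ⁅x (r.succAbove j), x r⁆
      rw [Fin.update_cons_zero, Fin.update_cons_zero] at this
      rw [this, hs]
      ring
    · rw [if_neg h.not_gt, if_pos h, add_zero, ← cons_bracket_removeNth G x r j h]
      have hs : (r.succAbove j).val = j.val + 1 := by
        rw [Fin.lt_succAbove_iff_le_castSucc] at h
        rw [Fin.succAbove_of_le_castSucc _ _ h, Fin.val_succ]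
      rw [hs]
      ring

/-! ### The map `φ` on decomposable vectors -/

/-- Evaluation of the tensor product of functionals at a fixed cochain. -/
noncomputable def evalTensor {n : ℕ} (f : G.Cochain n) :
    MultilinearMap R (fun _ : Fin n => G.Dist) R :=
  (LinearMap.applyₗ f).compMultilinearMap
    (tensorDual : MultilinearMap R (fun _ : Fin n => contDual (Fin m) R) _)

lemma evalTensor_apply {n : ℕ} (f : G.Cochain n) (Φ : Fin n → G.Dist) :
    G.evalTensor f Φ = tensorDual (Φ : Fin n → contDual (Fin m) R) f := rfl

lemma envToDist_ι (x : G.LieAlg) :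
    G.envToDist (UniversalEnvelopingAlgebra.ι R x) = G.toDist x := by
  simp only [envToDist, UniversalEnvelopingAlgebra.lift_ι_apply]
  rfl

/-- This is the working formula for `φ`: the enveloping algebra disappears, because the counit of 1
is 1 and generators map to tangent vectors. -/
lemma phi_ιMulti {n : ℕ} (f : G.Cochain n) (x : Fin n → G.LieAlg) :
    G.phi n f (exteriorPower.ιMulti R n x) =
      MultilinearMap.alternatization ((G.evalTensor f).compLinearMap fun _ => G.toDist) x := by
  -- By definition `κ` inserts 1, `ν` antisymmetrises, and `ι` multiplies by the counit of the first
  -- factor.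
  change LinearMap.mul' R R (TensorProduct.map G.counitAlg.toLinearMap (G.cochainToEnv n f)
    ((G.antisymm n).baseChange G.Env (1 ⊗ₜ exteriorPower.ιMulti R n x))) = _
  rw [LinearMap.baseChange_tmul, TensorProduct.map_tmul, LinearMap.mul'_apply]
  simp only [antisymm, AlgHom.toLinearMap_apply, map_one, one_mul, LinearMap.comp_apply,
    exteriorPower.toTensorPower_apply_ιMulti, map_sum, MultilinearMap.alternatization_apply]
  refine Finset.sum_congr rfl fun σ _ => ?_
  simp only [Units.smul_def, map_zsmul, PiTensorProduct.map_tprod]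
  congr 1
  refine (cochainToEnv_tprod G n f _).trans ?_
  rw [MultilinearMap.domDomCongr_apply, MultilinearMap.compLinearMap_apply, evalTensor_apply]
  congr 2
  funext i
  exact G.envToDist_ι _

end FormalGroupLaw

/-! ### Cofaces and the convolution product -/

/-- The value of a tensor product of functionals on a product of a power series in the groups of
variables `e i` and a monomial in the other groups of variables. -/
lemma tensorDual_subst_mul_monomial {R : Type*} [CommRing R] {m n n' : ℕ}
    (Φ : Fin n → contDual (Fin m) R) (e : Fin n' → Fin n) (he : Function.Injective e)
    (A : MvPowerSeries (Fin n' × Fin m) R) (c : Fin n × Fin m →₀ ℕ)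
    (hc : ∀ i j, c (e i, j) = 0) :
    tensorDual Φ (MvPowerSeries.subst (fun p => MvPowerSeries.X (R := R) (e p.1, p.2)) A *
      MvPowerSeries.monomial c 1) =
    tensorDual (fun i => Φ (e i)) A *
      ∏ k ∈ (Finset.univ.image e)ᶜ, (Φ k).1 (MvPowerSeries.monomial (expRow c k) 1) := by
  classical
  set q := ∏ k ∈ (Finset.univ.image e)ᶜ, (Φ k).1 (MvPowerSeries.monomial (expRow c k) 1)
    with hq
  have h0 : ∀ p : Fin n' × Fin m, MvPowerSeries.constantCoeff
      (MvPowerSeries.X (R := R) (e p.1, p.2)) = 0 := by simp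
  -- Both sides are continuous and linear in `A`, so monomials suffice. There the groups in the
  -- image of `e` see only `A` and the others see only `c`.
  have key := IsDegContinuous.ext_monomial (R := R)
    (((tensorDual_continuous Φ).comp_mulRight (MvPowerSeries.monomial c 1)).comp_subst h0)
    ((contDual (Fin n' × Fin m) R).smul_mem q (tensorDual_continuous fun i => Φ (e i))) ?_
  · have := DFunLike.congr_fun key A
    simp only [LinearMap.comp_apply, substLin_apply, LinearMap.mulRight_apply,
      LinearMap.smul_apply, smul_eq_mul] at this
    rw [this, mul_comm]
  · intro d
    have hX : MvPowerSeries.subst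
        (fun p : Fin n' × Fin m => MvPowerSeries.X (R := R) (e p.1, p.2))
        (MvPowerSeries.monomial d (1 : R)) =
        MvPowerSeries.monomial (d.mapDomain fun p => (e p.1, p.2)) 1 := by
      rw [MvPowerSeries.subst_monomial (MvPowerSeries.hasSubst_of_constantCoeff_zero h0)]
      simp [MvPowerSeries.monomial_mapDomain_apply_one]
    simp only [LinearMap.comp_apply, substLin_apply, LinearMap.mulRight_apply,
      LinearMap.smul_apply, smul_eq_mul, hX, MvPowerSeries.monomial_mul_monomial, one_mul,
      tensorDual_monomial]
    have hinj : Function.Injective (fun p : Fin n' × Fin m => (e p.1, p.2)) := by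
      rintro ⟨i, j⟩ ⟨i', j'⟩ h
      simp only [Prod.mk.injEq] at h ⊢
      exact ⟨he h.1, h.2⟩
    rw [← Finset.prod_compl_mul_prod (Finset.univ.image e), Finset.prod_image fun a _ b _ h => he h]
    congr 1
    · refine Finset.prod_congr rfl fun k hk => ?_
      congr 3
      ext j
      simp only [expRow, Finsupp.equivFunOnFinite_symm_apply_apply, Finsupp.add_apply]
      rw [Finsupp.mapDomain_of_notMem_range, zero_add]
      rintro ⟨p, hp⟩
      rw [Prod.mk.injEq] at hp
      simp only [Finset.mem_compl, Finset.mem_image, Finset.mem_univ, true_and] at hk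
      exact hk ⟨_, hp.1⟩
    · refine Finset.prod_congr rfl fun i _ => ?_
      congr 3
      ext j
      simp only [expRow, Finsupp.equivFunOnFinite_symm_apply_apply, Finsupp.add_apply]
      rw [hc, add_zero, show (e i, j) = (fun p : Fin n' × Fin m => (e p.1, p.2)) (i, j) from rfl,
        Finsupp.mapDomain_apply hinj]

namespace FormalGroupLaw

variable {R : Type*} [CommRing R] {m : ℕ} (G : FormalGroupLaw R m)

/-- The tuples of power series substituted in the `i`-th coface. -/
noncomputable def cofaceVars (n : ℕ) (i : Fin (n + 2)) (p : Fin n × Fin m) :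
    G.Cochain (n + 1) :=
  if p.1.val + 1 < i.val then slotVars R m p.1.castSucc p.2
  else if p.1.val + 1 = i.val then
    substPair G.series (slotVars R m p.1.castSucc) (slotVars R m p.1.succ) p.2
  else slotVars R m p.1.succ p.2

lemma constantCoeff_cofaceVars {n : ℕ} (i : Fin (n + 2)) (p : Fin n × Fin m) :
    MvPowerSeries.constantCoeff (G.cofaceVars n i p) = 0 := by
  rw [cofaceVars]
  split_ifs
  · simp [slotVars]
  · exact G.constantCoeff_substPair (by simp [slotVars]) (by simp [slotVars]) _
  · simp [slotVars]

lemma coface_apply {n : ℕ} (i : Fin (n + 2)) (f : G.Cochain n) :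
    G.coface n i f = substLin (G.cofaceVars n i) (G.constantCoeff_cofaceVars i) f :=
  (substLin_apply _ _ _).symm

lemma toDual_one (x : G.LieAlg) : (G.toDual x).1 1 = 0 := by
  simp [toDual_apply, differential_apply]

/-- Cofaces that only relabel the groups of variables are killed by `𝔤 ⊗ ⋯ ⊗ 𝔤`. -/
lemma tensorDual_toDual_coface_eq_zero {n : ℕ} (i : Fin (n + 2)) (t : Fin n → Fin (n + 1))
    (ht : ∀ p, G.cofaceVars n i p = MvPowerSeries.X (t p.1, p.2)) (k : Fin (n + 1))
    (hk : ∀ l, t l ≠ k) (x : Fin (n + 1) → G.LieAlg) (f : G.Cochain n) :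
    tensorDual (fun l => G.toDual (x l)) (G.coface n i f) = 0 := by
  rw [coface_apply, ← LinearMap.comp_apply]
  have key := IsDegContinuous.ext_monomial
    ((tensorDual_continuous fun l => G.toDual (x l)).comp_subst (G.constantCoeff_cofaceVars i))
    (contDual (Fin n × Fin m) R).zero_mem ?_
  · exact DFunLike.congr_fun key f
  · intro d
    rw [LinearMap.comp_apply, substLin_apply, subst_monomial_one (G.constantCoeff_cofaceVars i)]
    simp only [ht]
    have hX : (d.prod fun p a => (MvPowerSeries.X (t p.1, p.2) : G.Cochain (n + 1)) ^ a) =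
        MvPowerSeries.monomial (d.mapDomain fun p => (t p.1, p.2)) 1 := by
      rw [MvPowerSeries.monomial_mapDomain_apply_one]
    rw [hX, tensorDual_monomial, LinearMap.zero_apply]
    -- The group `k` does not occur, so its tangent vector is applied to the constant 1.
    refine Finset.prod_eq_zero (Finset.mem_univ k) ?_
    have h0 : expRow (d.mapDomain fun p : Fin n × Fin m => (t p.1, p.2)) k = 0 := by
      ext j
      simp only [expRow, Finsupp.equivFunOnFinite_symm_apply_apply, Finsupp.zero_apply]
      refine Finsupp.mapDomain_of_notMem_range _ _ ?_
      rintro ⟨p, hp⟩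
      exact hk _ (Prod.mk.inj hp).1
    rw [h0]
    exact G.toDual_one _

lemma evalTensor_coface_zero {n : ℕ} (x : Fin (n + 1) → G.LieAlg) (f : G.Cochain n) :
    G.evalTensor (G.coface n 0 f) (fun l => G.toDist (x l)) = 0 :=
  G.tensorDual_toDual_coface_eq_zero 0 Fin.succ (fun p => by simp [cofaceVars, slotVars]) 0
    Fin.succ_ne_zero x f

lemma evalTensor_coface_last {n : ℕ} (x : Fin (n + 1) → G.LieAlg) (f : G.Cochain n) :
    G.evalTensor (G.coface n (Fin.last (n + 1)) f) (fun l => G.toDist (x l)) = 0 :=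
  G.tensorDual_toDual_coface_eq_zero (Fin.last (n + 1)) Fin.castSucc
    (fun p => by simp [cofaceVars, slotVars]) (Fin.last n) Fin.castSucc_ne_last x f

/-- Substituting `G` into one slot is the comultiplication on that slot, and convolution is its
dual. On a monomial the slot `i` separates from the others, which are merely relabelled; continuity
gives the rest. -/
lemma tensorDual_coface {n : ℕ} (i : Fin n) (f : G.Cochain n)
    (Φ : Fin (n + 1) → contDual (Fin m) R) (Ψ : Fin n → contDual (Fin m) R)
    (hi : Ψ i = G.convMul (Φ i.castSucc) (Φ i.succ))
    (hk : ∀ k, k ≠ i → Ψ k = Φ (i.castSucc.succAbove k)) :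
    tensorDual Φ (G.coface n i.succ.castSucc f) = tensorDual Ψ f := by
  classical
  have hc := G.constantCoeff_cofaceVars i.succ.castSucc
  rw [coface_apply, ← LinearMap.comp_apply]
  have key := IsDegContinuous.ext_monomial ((tensorDual_continuous Φ).comp_subst hc)
    (tensorDual_continuous Ψ) ?_
  · exact DFunLike.congr_fun key f
  intro d
  -- The relabelling of the untouched groups. Its value at `i` is `i.succ`, one of the two merged
  -- groups, so it matters only away from `i`.
  set t : Fin n → Fin (n + 1) := i.castSucc.succAbove with ht
  have htk : ∀ k, t k = if k < i then k.castSucc else k.succ := fun k => rfl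
  -- Row `i` of the exponent receives the comultiplication; `d'` collects the other rows.
  set d' := d.filter fun p => p.1 ≠ i with hd'
  have hrow : Function.Injective fun j : Fin m => (i, j) := fun a b h => by simpa using h
  have hd : d = (expRow d i).mapDomain (fun j => (i, j)) + d' := by
    ext ⟨k, j⟩
    rw [Finsupp.add_apply, hd']
    by_cases h : k = i
    · subst h
      rw [Finsupp.mapDomain_apply hrow, Finsupp.filter_apply_neg _ _ (by simp)]
      simp [expRow]
    · rw [Finsupp.mapDomain_of_notMem_range _ _ (by simp [Ne.symm h]),
        Finsupp.filter_apply_pos _ _ (by simpa using h), zero_add]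
  have hs : ∀ (l : Fin (n + 1)) (j : Fin m),
    MvPowerSeries.constantCoeff (slotVars R m l j) = 0 := by simp [slotVars]
  set e : Fin 2 → Fin (n + 1) := ![i.castSucc, i.succ] with he
  have he_inj : Function.Injective e := by
    intro a b
    fin_cases a <;> fin_cases b <;> simp [he, Fin.castSucc_lt_succ.ne, Fin.castSucc_lt_succ.ne']
  have hte : ∀ (k : Fin n) (b : Fin 2), k ≠ i → t k ≠ e b := by
    intro k b hk h
    have hv := congrArg Fin.val h
    have hk' : k.val ≠ i.val := fun h => hk (Fin.ext h)
    rw [htk] at hv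
    by_cases hlt : k < i
    · have hlt' : k.val < i.val := hlt
      rw [if_pos hlt] at hv
      fin_cases b <;> simp [he] at hv <;> omega
    · have hlt' : ¬ k.val < i.val := hlt
      rw [if_neg hlt] at hv
      fin_cases b <;> simp [he] at hv <;> omega
  have h1 : MvPowerSeries.subst (G.cofaceVars n i.succ.castSucc)
      (MvPowerSeries.monomial d (1 : R)) =
      MvPowerSeries.subst (fun p : Fin 2 × Fin m => MvPowerSeries.X (R := R) (e p.1, p.2))
        (G.comul (MvPowerSeries.monomial (expRow d i) 1)) *
      MvPowerSeries.monomial (d'.mapDomain fun p => (t p.1, p.2)) 1 := by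
    have h2 : (fun p : Fin 2 × Fin m => MvPowerSeries.X (R := R) (e p.1, p.2)) =
        fun p => ![slotVars R m i.castSucc, slotVars R m i.succ] p.1 p.2 := by
      funext ⟨b, j⟩
      fin_cases b <;> rfl
    rw [h2, G.subst_comul (hs _) (hs _), subst_monomial_one hc,
      subst_monomial_one (G.constantCoeff_substPair (hs _) (hs _)),
      MvPowerSeries.monomial_mapDomain_apply_one]
    conv_lhs => rw [hd]
    rw [Finsupp.prod_add_index' (by simp) (by simp [pow_add]),
      Finsupp.prod_mapDomain_index (by simp) (by simp [pow_add])]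
    congr 1
    · refine Finsupp.prod_congr fun j _ => ?_
      simp [cofaceVars]
    · refine Finsupp.prod_congr fun p hp => ?_
      have hpi : p.1 ≠ i := by
        rw [hd', Finsupp.support_filter, Finset.mem_filter] at hp
        exact hp.2
      have hpv : p.1.val ≠ i.val := fun h => hpi (Fin.ext h)
      simp only [cofaceVars, Fin.val_castSucc, Fin.val_succ, htk, slotVars]
      by_cases h : p.1 < i
      · rw [if_pos (by simpa using h), if_pos h]
      · rw [if_neg (by simpa using h), if_neg (by simpa using hpv), if_neg h]
  have hinj : Function.Injective (fun p : Fin n × Fin m => (t p.1, p.2)) := by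
    rintro ⟨k, j⟩ ⟨k', j'⟩ h
    simp only [Prod.mk.injEq] at h ⊢
    exact ⟨Fin.succAbove_right_injective h.1, h.2⟩
  -- The two merged groups and the relabelled ones partition the `n + 1` groups, so the product of
  -- functionals splits accordingly.
  have hcol : (Finset.univ.image e)ᶜ = (Finset.univ.erase i).image t := by
    ext l
    simp only [Finset.mem_compl, Finset.mem_image, Finset.mem_univ, true_and, Finset.mem_erase,
      and_true]
    constructor
    · intro h
      have hl : l ≠ i.castSucc := fun hh => h ⟨0, by simp [he, hh]⟩
      obtain ⟨k, rfl⟩ := Fin.exists_succAbove_eq hl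
      refine ⟨k, ?_, rfl⟩
      rintro rfl
      exact h ⟨1, by simp [he]⟩
    · rintro ⟨k, hk, rfl⟩ ⟨b, hb⟩
      exact hte k b hk hb.symm
  rw [LinearMap.comp_apply, substLin_apply, h1,
    tensorDual_subst_mul_monomial _ e he_inj, tensorDual_monomial, hcol,
    Finset.prod_image fun a _ b _ h => Fin.succAbove_right_injective h,
    ← Finset.mul_prod_erase Finset.univ _ (Finset.mem_univ i)]
  · congr 1
    · have h4 : (fun b => Φ (e b)) = ![Φ i.castSucc, Φ i.succ] := by
        funext b
        fin_cases b <;> rfl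
      rw [hi, convMul_apply, h4]
    · refine Finset.prod_congr rfl fun k hk' => ?_
      have hki := Finset.ne_of_mem_erase hk'
      rw [hk k hki]
      congr 3
      ext j
      simp only [expRow, Finsupp.equivFunOnFinite_symm_apply_apply]
      rw [show (t k, j) = (fun p : Fin n × Fin m => (t p.1, p.2)) (k, j) from rfl,
        Finsupp.mapDomain_apply hinj, hd', Finsupp.filter_apply_pos _ _ (by simpa using hki)]
  · intro b j
    by_contra hne
    have hmem := Finsupp.mapDomain_support (Finsupp.mem_support_iff.2 hne)
    obtain ⟨p, hp, hpe⟩ := Finset.mem_image.1 hmem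
    rw [hd', Finsupp.support_filter, Finset.mem_filter] at hp
    exact hte p.1 b hp.2 (Prod.mk.inj hpe).1

/-- The coface of index `i + 1` is the one that merges the groups `i` and `i + 1`, counted from 0.
-/
lemma evalTensor_coface {n : ℕ} (i : Fin n) (f : G.Cochain n) (Φ : Fin (n + 1) → G.Dist) :
    G.evalTensor (G.coface n i.succ.castSucc f) Φ = G.evalTensor f (mergeAt i Φ) := by
  refine G.tensorDual_coface i f Φ (mergeAt (D := G.Dist) i Φ) ?_ fun k hk => ?_
  · change mergeAt (D := G.Dist) i Φ i = _
    rw [mergeAt, if_neg (lt_irrefl i), if_pos rfl]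
    rfl
  · change mergeAt (D := G.Dist) i Φ k = _
    rw [mergeAt, if_neg hk]
    rcases lt_or_gt_of_ne hk with h | h
    · rw [if_pos h, Fin.succAbove_of_castSucc_lt _ _ (by simpa using h)]
    · rw [if_neg h.not_gt, Fin.succAbove_of_le_castSucc _ _ (by simpa using h.le)]

/-- `φ` commutes with the differentials. -/
lemma phi_coboundary [IsDomain R] [CharZero R] (n : ℕ) (f : G.Cochain n)
    (x : Fin (n + 1) → G.LieAlg) :
    G.phi (n + 1) (G.coboundary n f) (exteriorPower.ιMulti R (n + 1) x) =
      G.lieCoboundary (G.phi n f) x := by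
  -- The outer cofaces vanish on tangent vectors, so only the indices `i + 1` with `i < n` survive;
  -- hence the exponent `i + 1`.
  have hM : ∀ y : Fin (n + 1) → G.LieAlg,
      G.evalTensor (G.coboundary n f) (fun l => G.toDist (y l)) =
        ∑ i : Fin n, (-1) ^ (i.val + 1) *
          G.evalTensor f (mergeAt i fun l => G.toDist (y l)) := by
    intro y
    have h1 : G.evalTensor (G.coboundary n f) (fun l => G.toDist (y l)) =
        ∑ i : Fin (n + 2), (-1) ^ i.val *
          G.evalTensor (G.coface n i f) (fun l => G.toDist (y l)) := by
      simp only [evalTensor_apply, coboundary, map_sum]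
      refine Finset.sum_congr rfl fun i _ => ?_
      rcases Nat.even_or_odd i.val with h' | h' <;>
      simp [h'.neg_one_pow]
    rw [h1, Fin.sum_univ_castSucc, Fin.sum_univ_succ, evalTensor_coface_last, Fin.castSucc_zero,
      evalTensor_coface_zero, mul_zero, mul_zero, add_zero, zero_add]
    simp only [evalTensor_coface]
    simp
  -- The identity is proved after doubling: on the left 2 produces commutators, on the right it
  -- counts each pair in both orders.
  have h2 : (2 : R) ≠ 0 := two_ne_zero
  refine mul_left_cancel₀ h2 ?_
  have hA : ∀ r s : Fin (n + 1), G.phi n f (exteriorPower.ιMulti R n (G.bracketTuple x r s)) =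
      MultilinearMap.alternatization ((G.evalTensor f).compLinearMap fun _ => G.toDist)
        (G.bracketTuple x r s) := fun r s => G.phi_ιMulti f _
  simp only [lieCoboundary, hA]
  rw [← sum_alternating_update_bracket, ← sum_sign_update_bracket, phi_ιMulti,
    MultilinearMap.alternatization_apply]
  simp only [MultilinearMap.domDomCongr_apply]
  have h3 : ∀ σ : Equiv.Perm (Fin (n + 1)),
      (G.evalTensor (G.coboundary n f)).compLinearMap (fun _ => G.toDist) (fun k => x (σ k)) =
      ∑ i : Fin n, (-1) ^ (i.val + 1) *
          G.evalTensor f (mergeAt i fun l => G.toDist (x (σ l))) := fun σ => hM _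
  simp only [h3, Finset.smul_sum]
  rw [Finset.sum_comm, Finset.mul_sum, ← Finset.sum_neg_distrib]
  refine Finset.sum_congr rfl fun i _ => ?_
  have h4 := two_mul_sum_sign_mergeAt (G.evalTensor f) G.toDist G.toDist_lie i x
  -- The sign `(-1)^i` of the cycle meets the coface sign `(-1)^(i+1)`, leaving the single minus of
  -- the sum over ordered pairs.
  have h5 : ((-1 : R) ^ i.val) * (-1) ^ i.val = 1 := by rw [← mul_pow]; simp
  simp only [← mul_smul_comm, ← Finset.mul_sum]
  rw [pow_succ]
  linear_combination (-(-1) ^ i.val) * h4 - (∑ σ : Equiv.Perm (Fin (n + 1)),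
    Equiv.Perm.sign σ • (G.evalTensor f).compLinearMap (fun _ => G.toDist)
      (Function.update (fun k : Fin n => x (σ k.succ)) i ⁅x (σ 0), x (σ i.succ)⁆)) * h5

/-! ### Continuity, values on pure tensors and uniqueness -/

lemma toDual_monomial_eq_zero (x : G.LieAlg) {d : Fin m →₀ ℕ} (hd : d.degree ≠ 1) :
    (G.toDual x).1 (MvPowerSeries.monomial d 1) = 0 := by
  classical
  rw [toDual_apply, differential_apply]
  refine Finset.sum_eq_zero fun j _ => ?_
  rw [← MvPowerSeries.coeff_zero_eq_constantCoeff_apply, MvPowerSeries.coeff_pderiv,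
    MvPowerSeries.coeff_monomial, if_neg, zero_mul, mul_zero]
  rintro rfl
  simp at hd

lemma toDual_monomial_single (x : G.LieAlg) (j : Fin m) :
    (G.toDual x).1 (MvPowerSeries.monomial (Finsupp.single j 1) 1) = x j := by
  rw [toDual_apply, differential_apply, Finset.sum_eq_single j]
  · change x j * MvPowerSeries.constantCoeff (MvPowerSeries.pderiv R j (MvPowerSeries.X j)) = _
    simp
  · intro k _ hk
    change x k * MvPowerSeries.constantCoeff (MvPowerSeries.pderiv R k (MvPowerSeries.X j)) = _
    rw [MvPowerSeries.pderiv_X_of_ne hk.symm, map_zero, mul_zero]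
  · simp

lemma degree_eq_sum_expRow {n : ℕ} (d : Fin n × Fin m →₀ ℕ) :
    d.degree = ∑ i, (expRow d i).degree := by
  simp only [Finsupp.degree_eq_sum, expRow, Finsupp.equivFunOnFinite_symm_apply_apply]
  exact Fintype.sum_prod_type _

/-- A monomial contributes only if it has degree one in each of the `n` groups, hence total degree
exactly `n`. -/
lemma evalTensor_toDist_eq_zero {n : ℕ} {f : G.Cochain n}
    (hf : f ∈ degFiltration (Fin n × Fin m) R (n + 1)) (x : Fin n → G.LieAlg) :
    G.evalTensor f (fun i => G.toDist (x i)) = 0 := by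
  change tensorDual (fun i => G.toDual (x i)) f = 0
  refine (tensorDual_continuous _).apply_eq_zero (fun d hd => ?_) hf
  rw [tensorDual_monomial]
  obtain ⟨i, hi⟩ : ∃ i, (expRow d i).degree ≠ 1 := by
    by_contra! h
    rw [degree_eq_sum_expRow, Finset.sum_congr rfl fun i _ => h i] at hd
    simp at hd
  exact Finset.prod_eq_zero (Finset.mem_univ i) (G.toDual_monomial_eq_zero (x i) hi)

lemma phi_continuous (n : ℕ) : IsDegContinuous (G.phi n) := by
  refine ⟨n + 1, fun f hf => ?_⟩
  refine exteriorPower.linearMap_ext ?_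
  ext x
  change G.phi n f (exteriorPower.ιMulti R n x) = 0
  rw [phi_ιMulti, MultilinearMap.alternatization_apply]
  refine Finset.sum_eq_zero fun σ _ => ?_
  rw [MultilinearMap.domDomCongr_apply]
  have := G.evalTensor_toDist_eq_zero hf fun i => x (σ i)
  exact (congrArg _ this).trans (smul_zero _)

/-- Because of this, values on pure tensors determine a continuous map. -/
lemma pureTensor_monomial {n : ℕ} (d : Fin n × Fin m →₀ ℕ) :
    G.pureTensor (fun i => MvPowerSeries.monomial (expRow d i) 1) =
      MvPowerSeries.monomial d 1 := by
  have hs : ∀ (l : Fin n) (j : Fin m),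
    MvPowerSeries.constantCoeff (slotVars R m l j) = 0 := by simp [slotVars]
  simp only [pureTensor, subst_monomial_one (hs _)]
  rw [MvPowerSeries.monomial_one_eq, Finsupp.prod_fintype _ _ (by simp), Fintype.prod_prod_type]
  refine Finset.prod_congr rfl fun i _ => ?_
  rw [Finsupp.prod_fintype _ _ (by simp)]
  rfl

/-- Both sides are continuous and linear in each factor separately, so the factors can be reduced to
monomials one at a time. -/
lemma tensorDual_pureTensor {n : ℕ} (Φ : Fin n → contDual (Fin m) R)
    (f : Fin n → MvPowerSeries (Fin m) R) :
    tensorDual Φ (G.pureTensor f) = ∏ i, (Φ i).1 (f i) := by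
  classical
  -- The set `s` holds the slots whose entry is arbitrary, the others being monomials. Adding a slot
  -- `i` to `s` uses the case `s` for every monomial in slot `i`.
  suffices H : ∀ (s : Finset (Fin n)) (f : Fin n → MvPowerSeries (Fin m) R),
      (∀ i, i ∉ s → ∃ d, f i = MvPowerSeries.monomial d 1) →
      tensorDual Φ (G.pureTensor f) = ∏ i, (Φ i).1 (f i) from
    H Finset.univ f fun i hi => absurd (Finset.mem_univ i) hi
  intro s
  induction s using Finset.induction_on with
  | empty =>
    intro f hf
    choose d hd using fun i => hf i (Finset.notMem_empty i)
    obtain rfl : f = fun i => MvPowerSeries.monomial (d i) 1 := funext hd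
    have hrow : ∀ i, expRow (Finsupp.equivFunOnFinite.symm fun p : Fin n × Fin m => d p.1 p.2) i =
        d i := by
      intro i
      ext j
      simp [expRow]
    have := G.pureTensor_monomial (Finsupp.equivFunOnFinite.symm fun p => d p.1 p.2)
    simp only [hrow] at this
    rw [this, tensorDual_monomial]
    simp only [hrow]
  | insert i s _ ih =>
    intro f hf
    have hs : ∀ j : Fin m, MvPowerSeries.constantCoeff (slotVars R m i j) = 0 := by
      simp [slotVars]
    set rest := ∏ k ∈ Finset.univ.erase i, MvPowerSeries.subst (slotVars R m k) (f k) with hrest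
    have hupd : ∀ g, G.pureTensor (Function.update f i g) =
        MvPowerSeries.subst (slotVars R m i) g * rest := by
      intro g
      rw [pureTensor, ← Finset.mul_prod_erase Finset.univ _ (Finset.mem_univ i),
        Function.update_self]
      congr 1
      refine Finset.prod_congr rfl fun k hk => ?_
      rw [Function.update_of_ne (Finset.ne_of_mem_erase hk)]
    set q := ∏ k ∈ Finset.univ.erase i, (Φ k).1 (f k) with hq
    have hprod : ∀ g, ∏ k, (Φ k).1 (Function.update f i g k) = q * (Φ i).1 g := by
      intro g
      rw [← Finset.prod_erase_mul Finset.univ _ (Finset.mem_univ i), Function.update_self]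
      congr 1
      refine Finset.prod_congr rfl fun k hk => ?_
      rw [Function.update_of_ne (Finset.ne_of_mem_erase hk)]
    have key := IsDegContinuous.ext_monomial
      (((tensorDual_continuous Φ).comp_mulRight rest).comp_subst hs)
      ((contDual (Fin m) R).smul_mem q (Φ i).2) ?_
    · have := DFunLike.congr_fun key (f i)
      simp only [LinearMap.comp_apply, substLin_apply, LinearMap.mulRight_apply,
        LinearMap.smul_apply, smul_eq_mul] at this
      rwa [← hupd, ← hprod, Function.update_eq_self] at this
    · intro d
      simp only [LinearMap.comp_apply, substLin_apply, LinearMap.mulRight_apply,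
        LinearMap.smul_apply, smul_eq_mul]
      rw [← hupd, ← hprod]
      refine ih _ fun k hk => ?_
      by_cases hki : k = i
      · subst hki
        exact ⟨d, Function.update_self ..⟩
      · rw [Function.update_of_ne hki]
        exact hf k (by simp [hki, hk])

/-- The alternation of a product of values is the Leibniz expansion of the determinant, permutation
by permutation. -/
lemma phi_pureTensor {n : ℕ} (f : Fin n → MvPowerSeries (Fin m) R) :
    G.phi n (G.pureTensor f) = G.wedgeDifferential f := by
  refine exteriorPower.linearMap_ext ?_
  ext x
  change G.phi n (G.pureTensor f) (exteriorPower.ιMulti R n x) =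
    G.wedgeDifferential f (exteriorPower.ιMulti R n x)
  rw [phi_ιMulti, wedgeDifferential, exteriorPower.pairingDual_ιMulti_ιMulti,
    Matrix.det_apply, MultilinearMap.alternatization_apply]
  refine Finset.sum_congr rfl fun σ _ => ?_
  congr 1
  exact G.tensorDual_pureTensor (fun i => G.toDual (x (σ i))) f

lemma phi_unique {n : ℕ} (ψ : G.Cochain n →ₗ[R] G.LieCochain n) (hψ : IsDegContinuous ψ)
    (h : ∀ f : Fin n → MvPowerSeries (Fin m) R, ψ (G.pureTensor f) = G.wedgeDifferential f) :
    ψ = G.phi n := by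
  refine hψ.ext_monomial (G.phi_continuous n) fun d => ?_
  rw [← G.pureTensor_monomial, h, phi_pureTensor]

/-- There is one permutation of the empty set, and the empty product of functionals is 1. -/
lemma phi_zero (r : R) (v : Fin 0 → G.LieAlg) :
    G.phi 0 (MvPowerSeries.C r) (exteriorPower.ιMulti R 0 v) = r := by
  have h : (MvPowerSeries.C r : G.Cochain 0) = r • MvPowerSeries.monomial 0 1 := by
    rw [MvPowerSeries.monomial_zero_one, MvPowerSeries.smul_eq_C_mul, mul_one]
  rw [h, map_smul, LinearMap.smul_apply, phi_ιMulti, MultilinearMap.alternatization_apply,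
    Fintype.sum_unique, MultilinearMap.domDomCongr_apply, MultilinearMap.compLinearMap_apply,
    evalTensor_apply]
  refine (congrArg (fun a => r • (_ • a)) (tensorDual_monomial _ 0)).trans ?_
  simp

end FormalGroupLaw

/-! ### Convergent power series in several variables as analytic functions -/

/-- The multilinear map `(v_i) ↦ ∏ v_i(e_i)`. -/
noncomputable def coordProd {σ K : Type*} [NontriviallyNormedField K] {k : ℕ} (e : Fin k → σ) :
    ContinuousMultilinearMap K (fun _ : Fin k => σ → K) K :=
  (ContinuousMultilinearMap.mkPiAlgebra K (Fin k) K).compContinuousLinearMap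
    fun i => ContinuousLinearMap.proj (e i)

lemma coordProd_apply {σ K : Type*} [NontriviallyNormedField K] {k : ℕ} (e : Fin k → σ)
    (v : Fin k → σ → K) :
    coordProd e v = ∏ i, v i (e i) := rfl

section PowerSeries

variable {σ : Type*}

noncomputable instance fintypeDegreeEq [Fintype σ] (k : ℕ) : Fintype {d : σ →₀ ℕ // d.degree = k} :=
  ((finite_degree_lt (k + 1)).subset fun d (hd : d.degree = k) => by
    simp [hd]).fintype

/-- List the elements of the multiset in which each variable occurs as often as its exponent. -/
lemma exists_sum_single_eq {k : ℕ} (d : {d : σ →₀ ℕ // d.degree = k}) :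
    ∃ e : Fin k → σ, ∑ i, Finsupp.single (e i) 1 = d.1 := by
  classical
  obtain ⟨d, rfl⟩ := d
  have hcard : (Finsupp.toMultiset d).toList.length = d.degree := by
    rw [Multiset.length_toList, Finsupp.card_toMultiset]
    rfl
  refine ⟨fun i => (Finsupp.toMultiset d).toList.get (i.cast hcard.symm), ?_⟩
  refine Multiset.toFinsupp.symm.injective ?_
  change Finsupp.toMultiset _ = Finsupp.toMultiset d
  rw [map_sum]
  simp only [Finsupp.toMultiset_single, one_smul]
  refine (Equiv.sum_comp (finCongr hcard.symm) fun i =>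
    ({(Finsupp.toMultiset d).toList.get i} : Multiset σ)).trans ?_
  conv_rhs => rw [← Multiset.coe_toList (Finsupp.toMultiset d)]
  generalize (Finsupp.toMultiset d).toList = l
  induction l with
  | nil => simp
  | cons a l ih =>
    refine (Fin.sum_univ_succ (n := l.length) _).trans ?_
    exact congrArg (({a} : Multiset σ) + ·) ih

/-- The variables of a monomial of degree `k`, with multiplicity, in some order. -/
noncomputable def monomialVars {k : ℕ} (d : {d : σ →₀ ℕ // d.degree = k}) : Fin k → σ :=
  (exists_sum_single_eq d).choose

lemma sum_single_monomialVars {k : ℕ} (d : {d : σ →₀ ℕ // d.degree = k}) :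
    ∑ i, Finsupp.single (monomialVars d i) 1 = d.1 := (exists_sum_single_eq d).choose_spec

variable [Fintype σ]

/-- A monomial is recovered from the ordered list of its variables. This crude count decides the
radius of convergence chosen below. -/
lemma card_degreeEq_le (k : ℕ) :
    Fintype.card {d : σ →₀ ℕ // d.degree = k} ≤ Fintype.card σ ^ k := by
  classical
  have h : Function.Injective (monomialVars (σ := σ) (k := k)) := fun d d' h => by
    rw [Subtype.ext_iff, ← sum_single_monomialVars d, h, sum_single_monomialVars d']
  simpa using Fintype.card_le_of_injective _ h

/-- On the diagonal the arbitrary order chosen for the variables is immaterial. -/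
lemma prod_monomialVars {S : Type*} [CommMonoid S] {k : ℕ} (d : {d : σ →₀ ℕ // d.degree = k})
    (z : σ → S) : ∏ i, z (monomialVars d i) = ∏ s, z s ^ d.1 s := by
  classical
  have h : ∀ s, d.1 s = ∑ i, Finsupp.single (monomialVars d i) 1 s := fun s => by
    conv_lhs => rw [← sum_single_monomialVars d]
    rw [Finsupp.finsetSum_apply]
  simp only [h, ← Finset.prod_pow_eq_pow_sum]
  rw [Finset.prod_comm]
  refine Finset.prod_congr rfl fun i _ => ?_
  rw [Finset.prod_eq_single (monomialVars d i)]
  · simp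
  · intro s _ hs
    simp [hs.symm]
  · simp

variable {K : Type*} [NontriviallyNormedField K]

lemma norm_coordProd_le {k : ℕ} (e : Fin k → σ) : ‖coordProd (K := K) e‖ ≤ 1 := by
  refine ContinuousMultilinearMap.opNorm_le_bound zero_le_one fun v => ?_
  rw [coordProd_apply, norm_prod, one_mul]
  exact Finset.prod_le_prod (fun _ _ => norm_nonneg _) fun i _ => norm_le_pi_norm (v i) (e i)

/-- The formal multilinear series of a power series in several variables. -/
noncomputable def MvPowerSeries.toFormalMultilinearSeries (F : MvPowerSeries σ K) :
    FormalMultilinearSeries K (σ → K) K := fun k =>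
  ∑ d : {d : σ →₀ ℕ // d.degree = k}, MvPowerSeries.coeff d.1 F • coordProd (monomialVars d)

lemma toFormalMultilinearSeries_apply (F : MvPowerSeries σ K) (k : ℕ) (v : Fin k → σ → K) :
    F.toFormalMultilinearSeries k v = ∑ d : {d : σ →₀ ℕ // d.degree = k},
      MvPowerSeries.coeff d.1 F * ∏ i, v i (monomialVars d i) := by
  simp only [MvPowerSeries.toFormalMultilinearSeries, sum_apply,
    smul_apply, coordProd_apply, smul_eq_mul]

/-- A function that is given near the origin by a convergent power series is analytic there. -/
lemma IsExpansionAtZero.hasFPowerSeriesOnBall {f : (σ → K) → K} {F : MvPowerSeries σ K}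
    (h : IsExpansionAtZero f F) :
    ∃ r, HasFPowerSeriesOnBall f F.toFormalMultilinearSeries 0 r := by
  obtain ⟨ε, hε, hball⟩ := Metric.eventually_nhds_iff_ball.1 h
  obtain ⟨c, hc0, hcε⟩ := NormedField.exists_norm_lt K hε
  have hN : (0 : ℝ) < Fintype.card σ + 1 := by positivity
  -- There are at most `(card σ)^k` monomials of degree `k`; dividing by `card σ + 1` outweighs this
  -- growth and never divides by zero.
  set r : ℝ := ‖c‖ / (Fintype.card σ + 1) with hr
  have hr0 : 0 < r := div_pos hc0 hN
  have hrc : r ≤ ‖c‖ := div_le_self hc0.le (by simp)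
  -- At the point with all coordinates `c` the series converges, so its terms tend to zero and are
  -- bounded.
  obtain ⟨C, hC⟩ : ∃ C : ℝ, ∀ d : σ →₀ ℕ, ‖MvPowerSeries.coeff d F‖ * ‖c‖ ^ d.degree ≤ C := by
    have hs := (hball (fun _ => c) (by
      rw [mem_ball_zero_iff]
      exact (pi_norm_const_le c).trans_lt hcε)).summable
    obtain ⟨C, hC⟩ := hs.tendsto_cofinite_zero.norm.isBoundedUnder_le.bddAbove_range_of_cofinite
    refine ⟨C, fun d => ?_⟩
    have := hC (Set.mem_range_self d)
    rwa [norm_mul, Finset.prod_pow_eq_pow_sum, norm_pow, ← Finsupp.degree_eq_sum] at this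
  have hC0 : 0 ≤ C := le_trans (by positivity) (hC 0)
  refine ⟨ENNReal.ofReal r, ⟨?_, by simpa using hr0, ?_⟩⟩
  · refine FormalMultilinearSeries.le_radius_of_bound _ C fun k => ?_
    rw [Real.coe_toNNReal _ hr0.le]
    have h1 : ‖F.toFormalMultilinearSeries k‖ ≤ (Fintype.card σ : ℝ) ^ k * (C / ‖c‖ ^ k) := by
      refine (norm_sum_le _ _).trans ((Finset.sum_le_card_nsmul _ _ (C / ‖c‖ ^ k) ?_).trans ?_)
      · intro d _
        rw [norm_smul, le_div_iff₀ (by positivity)]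
        refine le_trans ?_ (hC d.1)
        rw [d.2]
        gcongr
        exact mul_le_of_le_one_right (norm_nonneg _) (norm_coordProd_le _)
      · rw [nsmul_eq_mul]
        gcongr
        exact_mod_cast card_degreeEq_le k
    calc ‖F.toFormalMultilinearSeries k‖ * r ^ k
        ≤ (Fintype.card σ : ℝ) ^ k * (C / ‖c‖ ^ k) * r ^ k := by gcongr
      _ = C * (Fintype.card σ / (Fintype.card σ + 1)) ^ k := by
        rw [hr, div_pow, div_pow]
        field_simp
      _ ≤ C * 1 := by
        gcongr
        exact pow_le_one₀ (by positivity) (by rw [div_le_one hN]; linarith)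
      _ = C := mul_one C
  · intro y hy
    rw [zero_add]
    have hy' : y ∈ Metric.ball (0 : σ → K) ε := by
      rw [Metric.eball_ofReal] at hy
      exact Metric.ball_subset_ball (hrc.trans hcε.le) hy
    -- The sum over all exponents is regrouped by total degree.
    have hs := (Equiv.sigmaFiberEquiv (Finsupp.degree : (σ →₀ ℕ) → ℕ)).hasSum_iff.2 (hball y hy')
    refine HasSum.sigma hs fun k => ?_
    rw [toFormalMultilinearSeries_apply]
    simp only [prod_monomialVars]
    exact hasSum_fintype _

end PowerSeries

/-! ### Derivatives at the origin along the separate factors -/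

lemma expRow_sum_single {n m k : ℕ} (e : Fin k → Fin n × Fin m) (l : Fin n) :
    expRow (∑ i, Finsupp.single (e i) 1) l =
      ∑ i, if (e i).1 = l then Finsupp.single (e i).2 1 else 0 := by
  classical
  ext j
  simp only [expRow, Finsupp.equivFunOnFinite_symm_apply_apply, Finsupp.finsetSum_apply]
  refine Finset.sum_congr rfl fun i _ => ?_
  rw [Finsupp.single_apply]
  by_cases h : (e i).1 = l
  · rw [if_pos h, Finsupp.single_apply]
    refine if_congr ?_ rfl rfl
    rw [Prod.ext_iff]
    simp [h]
  · rw [if_neg h, if_neg fun hh => h (congrArg Prod.fst hh)]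
    rfl

namespace FormalGroupLaw

variable {K : Type*} [NontriviallyNormedField K] {m : ℕ} (G : FormalGroupLaw K m)

/-- A vector in slot `l` vanishes off group `l`, so `τ` contributes only if `τ i` is the group of `e
i` for every `i`. If `e` meets each group once, exactly one `τ` qualifies and its product is the
right side. -/
lemma sum_perm_slotVector {n : ℕ} (x : Fin n → G.LieAlg) (e : Fin n → Fin n × Fin m) :
    ∑ τ : Equiv.Perm (Fin n), ∏ i, G.slotVector (τ i) (x (τ i)) (e i) =
      ∏ l, (G.toDual (x l)).1
        (MvPowerSeries.monomial (expRow (∑ i, Finsupp.single (e i) 1) l) 1) := by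
  classical
  have hs : ∀ (l : Fin n) (y : G.LieAlg) (p : Fin n × Fin m),
      G.slotVector l y p = if p.1 = l then y p.2 else 0 := fun _ _ _ => rfl
  by_cases hb : Function.Bijective fun i => (e i).1
  · set τ₀ : Equiv.Perm (Fin n) := Equiv.ofBijective _ hb with hτ
    have hτi : ∀ i, τ₀ i = (e i).1 := fun _ => rfl
    rw [Finset.sum_eq_single τ₀, ← Equiv.prod_comp τ₀ fun l => (G.toDual (x l)).1
      (MvPowerSeries.monomial (expRow (∑ i, Finsupp.single (e i) 1) l) 1)]
    · refine Finset.prod_congr rfl fun i _ => ?_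
      rw [hs, if_pos (hτi i).symm, expRow_sum_single, Finset.sum_eq_single i,
        if_pos (hτi i).symm, toDual_monomial_single]
      · intro k _ hk
        rw [if_neg]
        intro h
        exact hk (τ₀.injective ((hτi k).trans h))
      · simp
    · intro τ _ hne
      obtain ⟨i, hi⟩ : ∃ i, τ i ≠ τ₀ i := by
        by_contra! h
        exact hne (Equiv.ext h)
      refine Finset.prod_eq_zero (Finset.mem_univ i) ?_
      rw [hs, if_neg]
      rw [← hτi]
      exact hi.symm
    · simp
  · have hsurj : ¬ Function.Surjective fun i => (e i).1 := fun h =>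
      hb (Finite.surjective_iff_bijective.1 h)
    -- Otherwise `e` misses a group `l`. Every `τ` then has a vanishing factor, and the right side
    -- has the tangent vector `x l` applied to 1.
    obtain ⟨l, hl⟩ := not_forall.1 hsurj
    push Not at hl
    rw [Finset.sum_eq_zero, Finset.prod_eq_zero (Finset.mem_univ l)]
    · refine G.toDual_monomial_eq_zero _ ?_
      rw [expRow_sum_single, Finset.sum_eq_zero fun i _ => if_neg (hl i)]
      simp
    · intro τ _
      refine Finset.prod_eq_zero (Finset.mem_univ (τ.symm l)) ?_
      rw [hs, if_neg]
      rw [Equiv.apply_symm_apply]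
      exact hl _

lemma tensorDual_toDual_eq_sum {n : ℕ} (x : Fin n → G.LieAlg) (F : G.Cochain n) :
    tensorDual (fun i => G.toDual (x i)) F =
      ∑ d : {d : Fin n × Fin m →₀ ℕ // d.degree = n}, MvPowerSeries.coeff d.1 F *
        ∏ i, (G.toDual (x i)).1 (MvPowerSeries.monomial (expRow d.1 i) 1) := by
  classical
  rw [tensorDual_apply, ← Finset.sum_image (s := Finset.univ)
    (g := (Subtype.val : {d : Fin n × Fin m →₀ ℕ // d.degree = n} → _))
    (f := fun d => MvPowerSeries.coeff d F *
        ∏ i, (G.toDual (x i)).1 (MvPowerSeries.monomial (expRow d i) 1))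
    (fun a _ b _ h => Subtype.ext h)]
  refine finsum_eq_sum_of_support_subset _ fun d hd => ?_
  simp only [Finset.coe_image, Finset.coe_univ, Set.image_univ, Subtype.range_coe_subtype,
    Set.mem_ofPred_eq]
  by_contra hdn
  refine hd (mul_eq_zero_of_right _ ?_)
  obtain ⟨i, hi⟩ : ∃ i, (expRow d i).degree ≠ 1 := by
    by_contra! h
    rw [degree_eq_sum_expRow, Finset.sum_congr rfl fun i _ => h i] at hdn
    simp at hdn
  exact Finset.prod_eq_zero (Finset.mem_univ i) (G.toDual_monomial_eq_zero (x i) hi)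

/-- The `n`-th derivative symmetrises the degree `n` term of the series over all orders of its
arguments. This makes the result independent of the variable order chosen in that term. -/
lemma iteratedFDeriv_slotVector [CompleteSpace K] {n : ℕ} {f : (Fin n × Fin m → K) → K}
    {F : G.Cochain n} (h : IsExpansionAtZero f F) (x : Fin n → G.LieAlg) :
    iteratedFDeriv K n f 0 (fun i => G.slotVector i (x i)) =
      tensorDual (fun i => G.toDual (x i)) F := by
  obtain ⟨r, hr⟩ := h.hasFPowerSeriesOnBall
  rw [hr.iteratedFDeriv_eq_sum_of_completeSpace, tensorDual_toDual_eq_sum]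
  simp only [toFormalMultilinearSeries_apply]
  rw [Finset.sum_comm]
  refine Finset.sum_congr rfl fun d _ => ?_
  rw [← Finset.mul_sum, sum_perm_slotVector, sum_single_monomialVars]

/-- On convergent power series, `φ` is the differentiation of analytic cochains. -/
lemma phi_eq_analyticDiff [CompleteSpace K] {n : ℕ} {f : (Fin n × Fin m → K) → K}
    {F : G.Cochain n} (h : IsExpansionAtZero f F) : G.phi n F = G.analyticDiff f := by
  refine exteriorPower.linearMap_ext ?_
  ext x
  change G.phi n F (exteriorPower.ιMulti K n x) = G.analyticDiff f (exteriorPower.ιMulti K n x)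
  rw [phi_ιMulti, analyticDiff, exteriorPower.alternatingMapLinearEquiv_apply_ιMulti,
    MultilinearMap.alternatization_apply, MultilinearMap.alternatization_apply]
  refine Finset.sum_congr rfl fun σ _ => ?_
  congr 1
  exact (G.iteratedFDeriv_slotVector h fun i => x (σ i)).symm

end FormalGroupLaw

theorem mainTheorem9 {R : Type*} [CommRing R] [IsDomain R] [CharZero R] {m : ℕ}
    (G : FormalGroupLaw R m) :
    -- `φ` is a morphism of complexes
    (∀ (n : ℕ) (f : G.Cochain n) (x : Fin (n + 1) → G.LieAlg),
      G.phi (n + 1) (G.coboundary n f) (exteriorPower.ιMulti R (n + 1) x) =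
        G.lieCoboundary (G.phi n f) x) ∧
    -- for `n ≥ 1`, `φ^n` is the unique continuous `R`-linear map with
    -- `f₁ ⊗ ⋯ ⊗ fₙ ↦ df₁ ∧ ⋯ ∧ dfₙ`
    (∀ n : ℕ, 1 ≤ n →
      IsDegContinuous (G.phi n) ∧
      (∀ f : Fin n → MvPowerSeries (Fin m) R, G.phi n (G.pureTensor f) = G.wedgeDifferential f) ∧
      ∀ ψ : G.Cochain n →ₗ[R] G.LieCochain n, IsDegContinuous ψ →
        (∀ f : Fin n → MvPowerSeries (Fin m) R, ψ (G.pureTensor f) = G.wedgeDifferential f) →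
        ψ = G.phi n) ∧
    -- `φ^0` is the identity, where `K^0(G, R) = R = C^0(𝔤, R)`
    (∀ (r : R) (v : Fin 0 → G.LieAlg),
      G.phi 0 (MvPowerSeries.C r) (exteriorPower.ιMulti R 0 v) = r) ∧
    -- over a `p`-adic field, `φ^n` is the differentiation of locally analytic cochains
    (∀ (p : ℕ) [Fact p.Prime] (K : Type*) [NontriviallyNormedField K] [NormedAlgebra ℚ_[p] K]
      [FiniteDimensional ℚ_[p] K] (h : R →+* K) (n : ℕ) (f : (Fin n × Fin m → K) → K)
      (F : (G.map h).Cochain n), IsExpansionAtZero f F →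
      (G.map h).phi n F = (G.map h).analyticDiff f) := by
  refine ⟨fun n f x => G.phi_coboundary n f x, fun n _ => ⟨G.phi_continuous n,
    fun f => G.phi_pureTensor f, fun ψ hψ h => G.phi_unique ψ hψ h⟩,
    fun r v => G.phi_zero r v, ?_⟩
  intro p _ K _ _ _ h n f F hF
  -- Completeness, needed to express the derivatives through the power series, comes from finite
  -- dimension over `ℚ_[p]`.
  have : CompleteSpace K := FiniteDimensional.complete ℚ_[p] K
  exact (G.map h).phi_eq_analyticDiff hF
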